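/- All graphs are finite, simple and undirected. Let $G$ be a graph whose vertices are colored (not necessarily properly). A set of vertices is rainbow if its elements have pairwise distinct colors. For two distinct vertices $x,y$ of $G$, a rainbow $x$-$y$ vertex-cut is a set $S\subseteq V(G)\setminus\{x,y\}$ such that: if $x$ and $y$ are nonadjacent, then $S$ is rainbow and $x$ and $y$ lie in different components of $G-S$; if $x$ and $y$ are adjacent, then $S\cup\{x\}$ or $S\cup\{y\}$ is rainbow and $x$ and $y$ lie in different components of $(G-xy)-S$. The rainbow vertex-disconnection number $\mathrm{rvd}(G)$ is the minimum number of colors in a vertex-coloring of $G$ for which every two distinct vertices $x,y$ have a rainbow $x$-$y$ vertex-cut. Let $\Delta(G)$ denote the maximum degree of $G$. Theorem. Every connected graph $G$ with at least two vertices that does not have $K_4$ as a minor satisfies $$\mathrm{rvd}(G)\le \Delta(G).$$ The bound is sharp: for every $n\ge 4$, the complete bipartite graph $K_{2,n-2}$ is connected, has no $K_4$ minor, and satisfies $\mathrm{rvd}(K_{2,n-2})=n-2=\Delta(K_{2,n-2})$. -/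

import Mathlib

namespace SimpleGraph

/-- `x` and `y` belong to different components of `G - S`; in particular neither of them lies
in `S`. -/
def InDifferentComponents {V : Type*} (G : SimpleGraph V) (S : Set V) (x y : V) : Prop :=
  ∃ (hx : x ∈ Sᶜ) (hy : y ∈ Sᶜ),
    (G.induce Sᶜ).connectedComponentMk ⟨x, hx⟩ ≠ (G.induce Sᶜ).connectedComponentMk ⟨y, hy⟩

/-- `S` is an `x`-`y` vertex-cut of `G`: if `x` and `y` are nonadjacent, they belong to different
components of `G - S`; if they are adjacent, they belong to different components of
`(G - xy) - S`. -/
def IsVertexCut {V : Type*} (G : SimpleGraph V) (x y : V) (S : Set V) : Prop :=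
  (¬ G.Adj x y → G.InDifferentComponents S x y) ∧
    (G.Adj x y → (G.deleteEdges {s(x, y)}).InDifferentComponents S x y)

/-- A vertex set is rainbow if no two of its vertices have the same color. -/
def IsRainbow {V C : Type*} (c : V → C) (S : Set V) : Prop :=
  ∀ u ∈ S, ∀ v ∈ S, u ≠ v → c u ≠ c v

/-- `S` is an `x`-`y` rainbow vertex-cut: a vertex-cut such that `S` is rainbow if `x` and `y` are
nonadjacent, and `S + x` or `S + y` is rainbow if `x` and `y` are adjacent. -/
def IsRainbowVertexCut {V C : Type*} (G : SimpleGraph V) (c : V → C) (x y : V) (S : Set V) :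
    Prop :=
  G.IsVertexCut x y S ∧
    (¬ G.Adj x y → IsRainbow c S) ∧
    (G.Adj x y → IsRainbow c (insert x S) ∨ IsRainbow c (insert y S))

/-- A vertex-coloring (not necessarily proper) is a rainbow vertex-disconnection coloring if any
two distinct vertices have a rainbow vertex-cut. -/
def IsRVDColoring {V C : Type*} (G : SimpleGraph V) (c : V → C) : Prop :=
  ∀ x y : V, x ≠ y → ∃ S : Set V, G.IsRainbowVertexCut c x y S

/-- The rainbow vertex-disconnection number: the minimum number of colors of a rainbow
vertex-disconnection coloring. -/
noncomputable def rvd {V : Type*} (G : SimpleGraph V) : ℕ :=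
  sInf {k : ℕ | ∃ c : V → Fin k, G.IsRVDColoring c}

/-- Coloring all vertices differently is a rainbow vertex-disconnection coloring. -/
theorem isRVDColoring_of_injective {V C : Type*} (G : SimpleGraph V) (c : V → C)
    (hc : Function.Injective c) : G.IsRVDColoring c := by
  intro x y hxy
  have hr : ∀ S : Set V, IsRainbow c S := fun S u _ v _ huv h => huv (hc h)
  have key : ∀ H : SimpleGraph V, ¬ H.Adj x y → H.InDifferentComponents {x, y}ᶜ x y := by
    intro H hH
    refine ⟨by simp, by simp, fun h => ?_⟩
    obtain ⟨w⟩ := ConnectedComponent.exact h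
    cases w with
    | nil => exact hxy rfl
    | @cons _ v _ hadj p =>
      obtain ⟨v, hv⟩ := v
      have hv' : v = x ∨ v = y := by simpa using hv
      have hadj' : H.Adj x v := hadj
      rcases hv' with rfl | rfl
      · exact H.irrefl hadj'
      · exact hH hadj'
  exact ⟨{x, y}ᶜ, ⟨fun h => key G h, fun _ => key _ (by simp)⟩, fun _ => hr _,
    fun _ => Or.inl (hr _)⟩

/-- On a finite vertex set the minimum in the definition of `rvd` is attained. -/
theorem exists_isRVDColoring_rvd {V : Type*} [Finite V] (G : SimpleGraph V) :
    ∃ c : V → Fin G.rvd, G.IsRVDColoring c :=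
  Nat.sInf_mem (s := {k : ℕ | ∃ c : V → Fin k, G.IsRVDColoring c})
    ⟨Nat.card V, Finite.equivFin V,
      G.isRVDColoring_of_injective _ (Finite.equivFin V).injective⟩

/-- `H` is a minor of `G`: there are pairwise disjoint vertex sets of `G`, one for each vertex of
`H`, each inducing a (nonempty) connected subgraph, such that for every edge of `H` there is an
edge of `G` between the corresponding sets. (Contracting the sets and deleting everything else
turns `G` into `H`.) -/
def IsMinor {W V : Type*} (H : SimpleGraph W) (G : SimpleGraph V) : Prop :=
  ∃ B : W → Set V,
    (∀ i, (G.induce (B i)).Connected) ∧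
    (∀ i j, i ≠ j → Disjoint (B i) (B j)) ∧
    (∀ i j, H.Adj i j → ∃ u ∈ B i, ∃ v ∈ B j, G.Adj u v)

/-- `G` does not have `K₄` as a minor. -/
def IsK4MinorFree {V : Type*} (G : SimpleGraph V) : Prop :=
  ¬ (completeGraph (Fin 4)).IsMinor G

end SimpleGraph

/-!
The maximum degrees one and two are treated directly: a connected graph of maximum degree two is a
path or a cycle, and one color for its first two vertices and another one for the rest suffice.

For `k ≥ 3` colors the bound is proved by induction for a stronger statement
(`IsK4MinorFree.exists_isStrongColoring`), in which some edges, those of a subgraph `F`, are marked.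
A marked edge `ab` is the trace of a part of the graph that hangs on `a` and `b` and has been
replaced by the edge; it counts twice in the degrees of its ends, and its ends are required to have
different colors, so that `{a, b}` is a rainbow cut between the replaced part and the rest. For
adjacent vertices `x`, `y` the cut is moreover required to have fewer elements than `x` and `y` have
neighbors. This is what leaves a color for a new vertex which has to be added to the cut between `x`
and `y`.

A `K₄`-minor-free graph with an edge contains a vertex of degree one, a vertex of degree two in a
triangle, two vertices of degree two with the same neighbors, or two adjacent vertices of degree two
(`IsK4MinorFree.exists_reducible`). Otherwise suppressing all vertices of degree two would give a
minor of minimum degree at least three, and such a graph has a `K₄` minor by an argument with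
longest paths (`not_isK4MinorFree_of_three_le`). In each of these cases one or two vertices of degree at
most two are made isolated and their outer neighbors, if there are two, are joined by an edge
(`reduce`), which creates no `K₄` minor. Cuts of the reduced graph remain cuts
(`HasCut.of_reduce`), except for the pair `a`, `b` of outer neighbors, where removed vertices join
the cut. The lemmas
`IsStrongColoring.exists_of_pendant`, `exists_of_triangle`, `exists_of_twins`, `exists_of_path` and
`exists_of_square` choose the colors of the removed vertices.

In `K_{2,m}` a cut between the two vertices of the small side contains the other side, which
therefore has `m` colors.
-/

namespace SimpleGraph

/-! ### Minors -/

/-- A set is connected as soon as all its points can be reached from one of them. -/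
theorem induce_connected_of_reach {V : Type*} {G : SimpleGraph V} {s : Set V} (u : V) (hu : u ∈ s)
    (h : ∀ w (hw : w ∈ s), (G.induce s).Reachable ⟨u, hu⟩ ⟨w, hw⟩) : (G.induce s).Connected :=
  induce_connected_of_patches u hu fun {w} hw => ⟨s, subset_rfl, hu, hw, h w hw⟩

theorem induce_star_connected {V : Type*} {G : SimpleGraph V} {s : Set V} (u : V) (hu : u ∈ s)
    (h : ∀ w ∈ s, w ≠ u → G.Adj u w) : (G.induce s).Connected := by
  refine induce_connected_of_reach u hu fun w hw => ?_
  by_cases hwu : w = u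
  · subst hwu; exact Reachable.refl _
  · exact Adj.reachable (by simpa using h w hw hwu)

/-- Replacing every vertex `x` of a graph `G'` by a connected set `φ x` of `G`, so that the edges of
`G'` are realised, turns a `K₄` minor of `G'` into one of `G`. Isolated vertices of `G'` cannot take
part in a `K₄` minor, so that nothing is asked of them. -/
theorem IsK4MinorFree.of_blowup {V U : Type*} {G' : SimpleGraph V} {G : SimpleGraph U}
    (φ : V → Set U) (hc : ∀ x ∈ G'.support, (G.induce (φ x)).Connected)
    (hd : ∀ x ∈ G'.support, ∀ y ∈ G'.support, x ≠ y → Disjoint (φ x) (φ y))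
    (ha : ∀ x y, G'.Adj x y → ∃ u ∈ φ x, ∃ w ∈ φ y, G.Adj u w)
    (hG : G.IsK4MinorFree) : G'.IsK4MinorFree := by
  rintro ⟨B, hB, hdis, hadj⟩
  have hsupp : ∀ i, ∀ x ∈ B i, x ∈ G'.support := by
    intro i x hx
    obtain ⟨j, hj⟩ := exists_ne i
    obtain ⟨u, hu, w, -, huw⟩ := hadj i j hj.symm
    by_cases hxu : x = u
    · subst hxu; exact huw.mem_support_left
    · obtain ⟨p⟩ := (hB i).preconnected ⟨x, hx⟩ ⟨u, hu⟩
      cases p with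
      | nil => exact absurd rfl hxu
      | cons h _ => exact Adj.mem_support_left (G := G') h
  refine hG ⟨fun i => ⋃ x ∈ B i, φ x, fun i => ?_, fun i j hij => ?_, fun i j hij => ?_⟩
  · set s : Set U := ⋃ x ∈ B i, φ x with hs
    have hsub : ∀ x ∈ B i, φ x ⊆ s := fun x hx => Set.subset_biUnion_of_mem (u := φ) hx
    have hin : ∀ x (hx : x ∈ B i) u w (hu : u ∈ φ x) (hw : w ∈ φ x),
        (G.induce s).Reachable ⟨u, hsub x hx hu⟩ ⟨w, hsub x hx hw⟩ := fun x hx u w hu hw =>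
      ((hc x (hsupp i x hx)).preconnected ⟨u, hu⟩ ⟨w, hw⟩).map
        (induceHomOfLE G (hsub x hx)).toHom
    have hwalk : ∀ x y : B i, (G'.induce (B i)).Reachable x y → ∀ u w (hu : u ∈ φ x) (hw : w ∈ φ y),
        (G.induce s).Reachable ⟨u, hsub x x.2 hu⟩ ⟨w, hsub y y.2 hw⟩ := by
      rintro x y ⟨p⟩
      induction p with
      | nil => intro u w hu hw; exact hin _ (Subtype.prop _) u w hu hw
      | @cons x z y h p ih =>
        intro u w hu hw
        obtain ⟨u', hu', w', hw', huw⟩ := ha x z h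
        refine (hin x x.2 u u' hu hu').trans (Reachable.trans ?_ (ih w' w hw' hw))
        exact Adj.reachable (by simpa using huw)
    obtain ⟨x⟩ := (hB i).nonempty
    obtain ⟨u⟩ := (hc x (hsupp i x x.2)).nonempty
    refine induce_connected_of_reach u (hsub x x.2 u.2) fun w hw => ?_
    obtain ⟨y, hy, hwy⟩ := Set.mem_iUnion₂.1 hw
    exact hwalk x ⟨y, hy⟩ ((hB i).preconnected _ _) u w u.2 hwy
  · refine Set.disjoint_left.2 fun u hu hu' => ?_
    obtain ⟨x, hx, hux⟩ := Set.mem_iUnion₂.1 hu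
    obtain ⟨y, hy, huy⟩ := Set.mem_iUnion₂.1 hu'
    have hxy : x ≠ y := by
      rintro rfl
      exact Set.disjoint_left.1 (hdis i j hij) hx hy
    exact Set.disjoint_left.1 (hd x (hsupp i x hx) y (hsupp j y hy) hxy) hux huy
  · obtain ⟨x, hx, y, hy, hxy⟩ := hadj i j hij
    obtain ⟨u, hu, w, hw, huw⟩ := ha x y hxy
    exact ⟨u, Set.mem_biUnion hx hu, w, Set.mem_biUnion hy hw, huw⟩

theorem IsK4MinorFree.mono {V : Type*} {G' G : SimpleGraph V} (h : G' ≤ G)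
    (hG : G.IsK4MinorFree) : G'.IsK4MinorFree :=
  hG.of_blowup (fun x => {x})
    (fun x _ => induce_star_connected x rfl fun _ hw hne => absurd hw hne)
    (fun _ _ _ _ hxy => Set.disjoint_singleton.2 hxy)
    fun x y hxy => ⟨x, rfl, y, rfl, h hxy⟩

/-- Trading a vertex `v` for an edge between two of its neighbors creates no `K₄` minor: the new
graph arises by contracting an edge at `v`. -/
theorem IsK4MinorFree.of_suppress {V : Type*} {G' G : SimpleGraph V} {v a b : V}
    (hv : v ∉ G'.support) (hva : G.Adj v a) (hvb : G.Adj v b)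
    (h : ∀ x y, G'.Adj x y → G.Adj x y ∨ x = a ∧ y = b ∨ x = b ∧ y = a)
    (hG : G.IsK4MinorFree) : G'.IsK4MinorFree := by
  refine hG.of_blowup (fun x => {u | u = x ∨ u = v ∧ x = a}) (fun x hx => ?_)
    (fun x hx y hy hxy => ?_) fun x y hxy => ?_
  · refine induce_star_connected x (Or.inl rfl) fun w hw hne => ?_
    rcases hw with rfl | ⟨rfl, rfl⟩
    · exact absurd rfl hne
    · exact hva.symm
  · refine Set.disjoint_left.2 ?_
    rintro u (rfl | ⟨rfl, rfl⟩) (h2 | ⟨h2, h3⟩)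
    · exact hxy h2
    · exact hv (h2 ▸ hx)
    · exact hv (h2 ▸ hy)
    · exact hxy h3.symm
  · rcases h x y hxy with h | ⟨rfl, rfl⟩ | ⟨rfl, rfl⟩
    · exact ⟨x, Or.inl rfl, y, Or.inl rfl, h⟩
    · exact ⟨v, Or.inr ⟨rfl, rfl⟩, y, Or.inl rfl, hvb⟩
    · exact ⟨x, Or.inl rfl, v, Or.inr ⟨rfl, rfl⟩, hvb.symm⟩

/-- Four connected sets, given one by one, that are disjoint and joined by edges in pairs. -/
theorem not_isK4MinorFree_of_sets {V : Type*} {G : SimpleGraph V} (B : Fin 4 → Set V)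
    (hB : ∀ i, (G.induce (B i)).Connected) (hd : ∀ i j, i < j → Disjoint (B i) (B j))
    (ha : ∀ i j, i < j → ∃ u ∈ B i, ∃ w ∈ B j, G.Adj u w) : ¬ G.IsK4MinorFree := by
  refine fun h => h ⟨B, hB, fun i j hij => ?_, fun i j hij => ?_⟩
  · rcases lt_or_gt_of_ne hij with h | h
    exacts [hd i j h, (hd j i h).symm]
  · rcases lt_or_gt_of_ne (show i ≠ j from hij) with h | h
    · exact ha i j h
    · obtain ⟨u, hu, w, hw, huw⟩ := ha j i h
      exact ⟨w, hw, u, hu, huw.symm⟩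

/-! ### Longest paths -/

/-- The vertices `f 0, …, f n` form a path of `G`; the values of `f` beyond `n` are irrelevant. -/
def IsPathSeq {V : Type*} (G : SimpleGraph V) (n : ℕ) (f : ℕ → V) : Prop :=
  Set.InjOn f (Set.Iic n) ∧ ∀ t < n, G.Adj (f t) (f (t + 1))

theorem IsPathSeq.lt_card {V : Type*} [Finite V] {G : SimpleGraph V} {n : ℕ} {f : ℕ → V}
    (h : G.IsPathSeq n f) : n < Nat.card V := by
  have h1 := Set.ncard_le_card (f '' Set.Iic n)
  rw [h.1.ncard_image] at h1
  simpa using h1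

/-- A graph with an edge has a longest path. -/
theorem exists_longest_isPathSeq {V : Type*} [Finite V] {G : SimpleGraph V} {x y : V}
    (hxy : G.Adj x y) :
    ∃ n f, 1 ≤ n ∧ G.IsPathSeq n f ∧ ∀ g, ¬ G.IsPathSeq (n + 1) g := by
  classical
  let P : ℕ → Prop := fun n => ∃ f, G.IsPathSeq n f
  have h1 : P 1 := by
    refine ⟨fun t => if t = 0 then x else y, ?_, ?_⟩
    · intro s hs t ht hst
      have hne := hxy.ne
      have hs' : s ≤ 1 := hs
      have ht' : t ≤ 1 := ht
      dsimp only at hst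
      split_ifs at hst with h1 h2 h2 <;> first | omega | (exfalso; simp_all)
    · intro t ht
      obtain rfl : t = 0 := by omega
      simpa using hxy
  have hb : ∀ m, P m → m ≤ Nat.card V := fun m ⟨f, hf⟩ => hf.lt_card.le
  refine ⟨Nat.findGreatest P (Nat.card V), ?_⟩
  obtain ⟨f, hf⟩ := Nat.findGreatest_spec (hb 1 h1) h1
  refine ⟨f, Nat.le_findGreatest (hb 1 h1) h1, hf, fun g hg => ?_⟩
  have := Nat.le_findGreatest (hb _ ⟨g, hg⟩) (P := P) ⟨g, hg⟩
  omega

/-- The first vertex of a longest path has all its neighbors on the path. -/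
theorem IsPathSeq.exists_eq_of_adj {V : Type*} {G : SimpleGraph V} {n : ℕ} {f : ℕ → V}
    (hf : G.IsPathSeq n f) (hmax : ∀ g, ¬ G.IsPathSeq (n + 1) g) {w : V} (hw : G.Adj (f 0) w) :
    ∃ t, 1 ≤ t ∧ t ≤ n ∧ f t = w := by
  by_contra! hno
  have hne : ∀ t ≤ n, f t ≠ w := by
    intro t ht
    rcases Nat.eq_zero_or_pos t with rfl | h
    exacts [hw.ne, hno t h ht]
  refine hmax (fun t => if t = 0 then w else f (t - 1)) ⟨?_, ?_⟩
  · intro s hs t ht hst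
    have hs' : s ≤ n + 1 := hs
    have ht' : t ≤ n + 1 := ht
    dsimp only at hst
    split_ifs at hst with h1 h2 h2
    · omega
    · exact absurd hst.symm (hne _ (by omega))
    · exact absurd hst (hne _ (by omega))
    · have := hf.1 (show s - 1 ≤ n by omega) (show t - 1 ≤ n by omega) hst
      omega
  · intro t ht
    rcases Nat.eq_zero_or_pos t with rfl | h
    · simpa using hw.symm
    · have := hf.2 (t - 1) (by omega)
      simpa [Nat.sub_add_cancel h, h.ne'] using this

/-- Rotating a path whose first vertex is adjacent to its vertex `i`: the initial segment before `i`
is reversed. -/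
theorem IsPathSeq.rotate {V : Type*} {G : SimpleGraph V} {n i : ℕ} {f : ℕ → V}
    (hf : G.IsPathSeq n f) (hi : 1 ≤ i) (hin : i ≤ n) (h0 : G.Adj (f 0) (f i)) :
    G.IsPathSeq n fun t => if t < i then f (i - 1 - t) else f t := by
  refine ⟨?_, ?_⟩
  · intro s hs t ht hst
    have hs' : s ≤ n := hs
    have ht' : t ≤ n := ht
    dsimp only at hst
    split_ifs at hst with h1 h2 h2
    all_goals
      have := hf.1 (by simp only [Set.mem_Iic]; omega) (by simp only [Set.mem_Iic]; omega) hst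
      omega
  · intro t ht
    by_cases h1 : t + 1 < i
    · have := hf.2 (i - 1 - (t + 1)) (by omega)
      rw [show i - 1 - (t + 1) + 1 = i - 1 - t by omega] at this
      simpa [h1, show t < i by omega] using this.symm
    · by_cases h2 : t < i
      · obtain rfl : i = t + 1 := by omega
        simpa using h0
      · simpa [h1, h2] using hf.2 t ht

theorem IsPathSeq.induce_image_connected {V : Type*} {G : SimpleGraph V} {n : ℕ} {f : ℕ → V}
    (hf : G.IsPathSeq n f) {i j : ℕ} (hij : i ≤ j) (hj : j ≤ n) :
    (G.induce (f '' Set.Icc i j)).Connected := by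
  refine induce_connected_of_reach (f i) ⟨i, ⟨le_rfl, hij⟩, rfl⟩ ?_
  suffices h : ∀ t (h1 : i ≤ t) (h2 : t ≤ j), (G.induce (f '' Set.Icc i j)).Reachable
      ⟨f i, i, ⟨le_rfl, hij⟩, rfl⟩ ⟨f t, t, ⟨h1, h2⟩, rfl⟩ by
    rintro w ⟨t, ⟨h1, h2⟩, rfl⟩
    exact h t h1 h2
  intro t h1
  induction t, h1 using Nat.le_induction with
  | base => intro _; exact Reachable.refl _
  | succ t h1 ih =>
    intro h2
    refine (ih (by omega)).trans (Adj.reachable ?_)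
    simpa using hf.2 t (by omega)

/-! ### Graphs of minimum degree three -/

/-- A set with at least three elements has one that avoids two given points. -/
theorem exists_mem_ne_ne {V : Type*} {s : Set V} (h : 3 ≤ s.ncard) (p q : V) :
    ∃ w ∈ s, w ≠ p ∧ w ≠ q := by
  have h1 := Set.exists_mem_notMem_of_ncard_lt_ncard (s := {p, q}) (t := s)
    (((Set.ncard_insert_le p {q}).trans_eq (by simp)).trans_lt (show 2 < _ from h))
  obtain ⟨w, hw, hw'⟩ := h1
  exact ⟨w, hw, by simpa [not_or] using hw'⟩

/-- If all vertices that are not isolated have degree at least three, then there is a `K₄` minor.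
Among all longest paths `f 0, …, f n` and all `i ≥ 2` with `f 0` adjacent to `f i`, let `i` be least.
A third neighbor of `f 0` lies beyond `i`, and, looking at the path rotated at `i`, so does one of
`f (i - 1)`. Hence `{f 0}`, `{f 1, …, f (i - 1)}`, `{f i}` and `{f (i + 1), …, f n}` are the branch
sets of a `K₄` minor. -/
theorem not_isK4MinorFree_of_three_le {V : Type*} [Finite V] {G : SimpleGraph V} {x y : V}
    (hxy : G.Adj x y) (hdeg : ∀ z ∈ G.support, 3 ≤ (G.neighborSet z).ncard) :
    ¬ G.IsK4MinorFree := by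
  classical
  obtain ⟨n, f, hn, hf, hmax⟩ := exists_longest_isPathSeq hxy
  have hthird : ∀ g, G.IsPathSeq n g → ∀ i, ∃ t, 2 ≤ t ∧ t ≤ n ∧ t ≠ i ∧ G.Adj (g 0) (g t) := by
    intro g hg i
    have h0 : g 0 ∈ G.support := (hg.2 0 (by omega)).mem_support_left
    obtain ⟨w, hw, hw1, hwi⟩ := exists_mem_ne_ne (hdeg _ h0) (g 1) (g i)
    obtain ⟨t, ht1, htn, rfl⟩ := hg.exists_eq_of_adj hmax hw
    refine ⟨t, ?_, htn, fun h => hwi (h ▸ rfl), hw⟩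
    rcases Nat.lt_or_ge t 2 with h | h
    · exact absurd (by rw [show t = 1 by omega]) hw1
    · exact h
  have hex : ∃ i, ∃ g, G.IsPathSeq n g ∧ 2 ≤ i ∧ i ≤ n ∧ G.Adj (g 0) (g i) := by
    obtain ⟨t, h2, htn, -, h⟩ := hthird f hf 0
    exact ⟨t, f, hf, h2, htn, h⟩
  obtain ⟨f, hf, hi2, hin, h0i⟩ := Nat.find_spec hex
  set i := Nat.find hex with hi
  have hbeyond : ∀ g, G.IsPathSeq n g → ∃ t, i < t ∧ t ≤ n ∧ G.Adj (g 0) (g t) := by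
    intro g hg
    obtain ⟨t, h2, htn, hti, h⟩ := hthird g hg i
    have : i ≤ t := Nat.find_min' hex ⟨g, hg, h2, htn, h⟩
    exact ⟨t, by omega, htn, h⟩
  obtain ⟨j, hij, hjn, h0j⟩ := hbeyond f hf
  obtain ⟨m, him, hmn, hm⟩ := hbeyond _ (hf.rotate (by omega) hin h0i)
  have hm' : G.Adj (f (i - 1)) (f m) := by
    simpa [show 0 < i by omega, show ¬ m < i by omega] using hm
  -- the branch sets are the intervals from `lo k` to `hi k` of the path
  let lo : Fin 4 → ℕ := ![0, 1, i, i + 1]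
  let hi : Fin 4 → ℕ := ![0, i - 1, i, n]
  refine not_isK4MinorFree_of_sets (fun k => f '' Set.Icc (lo k) (hi k)) (fun k => ?_)
    (fun k l hkl => ?_) fun k l hkl => ?_
  · apply hf.induce_image_connected <;> fin_cases k <;> simp [lo, hi] <;> omega
  · refine Set.disjoint_left.2 ?_
    rintro _ ⟨s, ⟨hs1, hs2⟩, rfl⟩ ⟨t, ⟨ht1, ht2⟩, hst⟩
    have hle : hi k < lo l ∧ hi l ≤ n := by
      fin_cases k <;> fin_cases l <;> simp [lo, hi] at hkl ⊢ <;> omega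
    have := hf.1 (show t ≤ n by omega) (show s ≤ n by omega) hst
    omega
  · have key : ∀ s t, G.Adj (f s) (f t) → lo k ≤ s → s ≤ hi k → lo l ≤ t → t ≤ hi l →
        ∃ u ∈ f '' Set.Icc (lo k) (hi k), ∃ w ∈ f '' Set.Icc (lo l) (hi l), G.Adj u w :=
      fun s t h h1 h2 h3 h4 => ⟨f s, ⟨s, ⟨h1, h2⟩, rfl⟩, f t, ⟨t, ⟨h3, h4⟩, rfl⟩, h⟩
    have h01 := hf.2 0 (by omega)
    have h12 := hf.2 (i - 1) (by omega)
    rw [show i - 1 + 1 = i by omega] at h12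
    have h23 := hf.2 i (by omega)
    fin_cases k <;> fin_cases l <;> first | exact absurd hkl (by decide) | skip
    · exact key 0 1 h01 (by simp [lo]) (by simp [hi]) (by simp [lo]) (by simp [hi]; omega)
    · exact key 0 i h0i (by simp [lo]) (by simp [hi]) (by simp [lo]) (by simp [hi])
    · exact key 0 j h0j (by simp [lo]) (by simp [hi]) (by simp [lo]; omega) (by simp [hi]; omega)
    · exact key (i - 1) i h12 (by simp [lo]; omega) (by simp [hi]) (by simp [lo]) (by simp [hi])
    · exact key (i - 1) m hm' (by simp [lo]; omega) (by simp [hi]) (by simp [lo]; omega)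
        (by simp [hi]; omega)
    · exact key i (i + 1) h23 (by simp [lo]) (by simp [hi]) (by simp [lo]) (by simp [hi]; omega)

/-- The graph that arises from `G` by suppressing all vertices of degree two: every such vertex is
isolated, and its two neighbors become adjacent. -/
def suppressTwo {V : Type*} (G : SimpleGraph V) : SimpleGraph V where
  Adj x y := x ≠ y ∧ (G.neighborSet x).ncard ≠ 2 ∧ (G.neighborSet y).ncard ≠ 2 ∧
    (G.Adj x y ∨ ∃ v, (G.neighborSet v).ncard = 2 ∧ G.Adj v x ∧ G.Adj v y)
  symm := ⟨by
    rintro x y ⟨h1, h2, h3, h4⟩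
    exact ⟨h1.symm, h3, h2, h4.imp (fun h => h.symm) fun ⟨v, h, h', h''⟩ => ⟨v, h, h'', h'⟩⟩⟩
  loopless := ⟨fun _ h => h.1 rfl⟩

theorem IsK4MinorFree.suppressTwo {V : Type*} {G : SimpleGraph V} (hG : G.IsK4MinorFree) :
    G.suppressTwo.IsK4MinorFree := by
  classical
  have hsel : ∀ v, ∃ p, (G.neighborSet v).ncard = 2 → G.Adj v p := by
    intro v
    by_cases h : (G.neighborSet v).ncard = 2
    · obtain ⟨a, b, -, hab⟩ := Set.ncard_eq_two.1 h
      exact ⟨a, fun _ => (G.mem_neighborSet v a).1 (hab ▸ Or.inl rfl)⟩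
    · exact ⟨v, fun h' => absurd h' h⟩
  -- every vertex of degree two is contracted into one of its neighbors
  choose p hp using hsel
  have htwo : ∀ x ∈ G.suppressTwo.support, (G.neighborSet x).ncard ≠ 2 :=
    fun x ⟨_, h⟩ => h.2.1
  refine hG.of_blowup (fun x => {u | u = x ∨ (G.neighborSet u).ncard = 2 ∧ p u = x})
    (fun x _ => ?_) (fun x hx y hy hxy => ?_) fun x y hxy => ?_
  · refine induce_star_connected x (Or.inl rfl) fun w hw hne => ?_
    rcases hw with rfl | ⟨h, rfl⟩
    · exact absurd rfl hne
    · exact (hp w h).symm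
  · refine Set.disjoint_left.2 ?_
    rintro u (rfl | ⟨h, h1⟩) (h2 | ⟨h2, h3⟩)
    · exact hxy h2
    · exact htwo _ hx h2
    · exact htwo _ hy (h2 ▸ h)
    · exact hxy (h1.symm.trans h3)
  · obtain ⟨hne, -, -, h | ⟨v, hv, hvx, hvy⟩⟩ := hxy
    · exact ⟨x, Or.inl rfl, y, Or.inl rfl, h⟩
    · obtain ⟨a, b, hab, hN⟩ := Set.ncard_eq_two.1 hv
      have hmem : ∀ z, G.Adj v z → z = a ∨ z = b := fun z hz => by
        have : z ∈ G.neighborSet v := hz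
        rwa [hN] at this
      have hpv : p v = x ∨ p v = y := by
        rcases hmem _ hvx with rfl | rfl <;> rcases hmem _ hvy with rfl | rfl <;>
          rcases hmem _ (hp v hv) with h | h <;> simp_all
      rcases hpv with h | h
      · exact ⟨v, Or.inr ⟨hv, h⟩, y, Or.inl rfl, hvy⟩
      · exact ⟨x, Or.inl rfl, v, Or.inr ⟨hv, h⟩, hvx.symm⟩

/-- A graph with an edge and without `K₄` minor contains a vertex of degree one, a vertex of degree
two with adjacent neighbors, two vertices of degree two with the same neighbors, or two adjacent
vertices of degree two. Otherwise, suppressing the vertices of degree two would neither create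
parallel edges nor lower a degree, so that all remaining degrees would be at least three. -/
theorem IsK4MinorFree.exists_reducible {V : Type*} [Finite V] {G : SimpleGraph V}
    (hG : G.IsK4MinorFree) {x y : V} (hxy : G.Adj x y) :
    (∃ v a, G.neighborSet v = {a}) ∨
    (∃ v a b, a ≠ b ∧ G.neighborSet v = {a, b} ∧ G.Adj a b) ∨
    (∃ v v' a b, v ≠ v' ∧ a ≠ b ∧ G.neighborSet v = {a, b} ∧ G.neighborSet v' = {a, b}) ∨
    (∃ v u a b, a ≠ u ∧ v ≠ b ∧ G.neighborSet v = {a, u} ∧ G.neighborSet u = {v, b}) := by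
  classical
  by_contra! hno
  obtain ⟨hone, htri, htwin, hpair⟩ := hno
  have hother : ∀ v w, (G.neighborSet v).ncard = 2 → G.Adj v w →
      ∃ o, o ≠ w ∧ G.neighborSet v = {w, o} := by
    intro v w hv hw
    obtain ⟨a, b, hab, hN⟩ := Set.ncard_eq_two.1 hv
    have : w ∈ G.neighborSet v := hw
    rw [hN] at this
    rcases this with rfl | rfl
    · exact ⟨b, hab.symm, hN⟩
    · exact ⟨a, hab, hN.trans (Set.pair_comm _ _)⟩
  have hmem : ∀ {v a b}, G.neighborSet v = {a, b} → G.Adj v a ∧ G.Adj v b := fun {v a b} h =>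
    ⟨(G.mem_neighborSet v a).1 (h ▸ Or.inl rfl), (G.mem_neighborSet v b).1 (h ▸ Or.inr rfl)⟩
  have hind : ∀ v u, G.Adj v u → (G.neighborSet v).ncard = 2 → (G.neighborSet u).ncard ≠ 2 := by
    intro v u hvu hv hu
    obtain ⟨a, ha, hNv⟩ := hother v u hv hvu
    obtain ⟨b, hb, hNu⟩ := hother u v hu hvu.symm
    exact hpair v u a b ha hb.symm (hNv.trans (Set.pair_comm _ _)) hNu
  have hge : ∀ z w, G.Adj z w → (G.neighborSet z).ncard ≠ 2 → 3 ≤ (G.neighborSet z).ncard := by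
    intro z w hzw h2
    have h0 : (G.neighborSet z).ncard ≠ 0 := by
      rw [Ne, Set.ncard_eq_zero]
      exact Set.Nonempty.ne_empty ⟨w, hzw⟩
    have h1 : (G.neighborSet z).ncard ≠ 1 := by
      intro h
      obtain ⟨a, ha⟩ := Set.ncard_eq_one.1 h
      exact hone z a ha
    omega
  have hle : ∀ z w, G.Adj z w → (G.neighborSet z).ncard ≠ 2 →
      3 ≤ (G.suppressTwo.neighborSet z).ncard := by
    intro z w hzw hz
    refine (hge z w hzw hz).trans ?_
    have hsel : ∀ u, ∃ o, G.Adj z u →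
        (((G.neighborSet u).ncard ≠ 2 ∧ o = u) ∨
          ((G.neighborSet u).ncard = 2 ∧ o ≠ z ∧ G.neighborSet u = {z, o})) := by
      intro u
      by_cases h : G.Adj z u
      · by_cases hu : (G.neighborSet u).ncard = 2
        · obtain ⟨o, ho, hN⟩ := hother u z hu h.symm
          exact ⟨o, fun _ => Or.inr ⟨hu, ho, hN⟩⟩
        · exact ⟨u, fun _ => Or.inl ⟨hu, rfl⟩⟩
      · exact ⟨u, fun h' => absurd h' h⟩
    -- a neighbor of degree two is replaced by its other neighbor
    choose o ho using hsel
    refine Set.ncard_le_ncard_of_injOn o (fun u hu => ?_) (fun u hu u' hu' huu => ?_)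
    · rcases ho u hu with ⟨h, h'⟩ | ⟨h, h', hN⟩
      · rw [h']
        exact ⟨hu.ne, hz, h, Or.inl hu⟩
      · exact ⟨h'.symm, hz, hind u _ (hmem hN).2 h, Or.inr ⟨u, h, hmem hN⟩⟩
    · rcases ho u hu with ⟨h, h'⟩ | ⟨h, h', hN⟩ <;>
        rcases ho u' hu' with ⟨k, k'⟩ | ⟨k, k', kN⟩
      · rw [← h', ← k', huu]
      · exact absurd (by rwa [← huu, h'] : G.Adj z (o u')) (htri u' z _ k'.symm kN)
      · exact absurd (by rwa [huu, k'] : G.Adj z (o u)) (htri u z _ h'.symm hN)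
      · by_contra hne
        exact htwin u u' z (o u) hne h'.symm hN (by rw [kN, huu])
  obtain ⟨z, w, hzw, hz⟩ : ∃ z w, G.Adj z w ∧ (G.neighborSet z).ncard ≠ 2 := by
    by_cases h : (G.neighborSet x).ncard = 2
    · exact ⟨y, x, hxy.symm, hind x y hxy h⟩
    · exact ⟨x, y, hxy, h⟩
  obtain ⟨w', hw', -⟩ := exists_mem_ne_ne (hle z w hzw hz) z z
  refine not_isK4MinorFree_of_three_le hw' (fun u hu => ?_) hG.suppressTwo
  obtain ⟨t, -, hu2, -, hut | ⟨v, -, hvu, -⟩⟩ := hu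
  · exact hle u t hut hu2
  · exact hle u v hvu.symm hu2

/-! ### Cuts -/

/-- `S` separates `x` from `y` in `G - xy` (which is `G` if `x` and `y` are nonadjacent), witnessed
by a vertex set `A` on the side of `x`. -/
def Separates {V : Type*} (G : SimpleGraph V) (S : Set V) (x y : V) : Prop :=
  x ∉ S ∧ y ∉ S ∧ ∃ A : Set V, x ∈ A ∧ y ∉ A ∧
    ∀ u ∈ A, ∀ w ∉ A, G.Adj u w → u ∈ S ∨ w ∈ S ∨ u = x ∧ w = y

theorem Separates.symm {V : Type*} {G : SimpleGraph V} {S : Set V} {x y : V}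
    (h : G.Separates S x y) : G.Separates S y x := by
  obtain ⟨hx, hy, A, hxA, hyA, hA⟩ := h
  refine ⟨hy, hx, Aᶜ, hyA, fun h => h hxA, fun u hu w hw huw => ?_⟩
  rcases hA w (not_not.1 hw) u hu huw.symm with h | h | ⟨h1, h2⟩
  exacts [Or.inr (Or.inl h), Or.inl h, Or.inr (Or.inr ⟨h2, h1⟩)]

theorem inDifferentComponents_of_crossing {V : Type*} {H : SimpleGraph V} {S A : Set V} {x y : V}
    (hx : x ∉ S) (hy : y ∉ S) (hxA : x ∈ A) (hyA : y ∉ A)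
    (hA : ∀ u ∈ A, ∀ w ∉ A, H.Adj u w → u ∈ S ∨ w ∈ S) : H.InDifferentComponents S x y := by
  refine ⟨hx, hy, fun h => hyA ?_⟩
  have hwalk : ∀ u w : (Sᶜ : Set V), (H.induce Sᶜ).Reachable u w → (u : V) ∈ A → (w : V) ∈ A := by
    rintro u w ⟨p⟩
    induction p with
    | nil => exact id
    | @cons u z w h p ih =>
      intro hu
      refine ih (by_contra fun hz => ?_)
      rcases hA u hu z hz h with h | h
      exacts [u.2 h, z.2 h]
  exact hwalk _ _ (ConnectedComponent.exact h) hxA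

theorem Separates.isVertexCut {V : Type*} {G : SimpleGraph V} {S : Set V} {x y : V}
    (h : G.Separates S x y) : G.IsVertexCut x y S := by
  obtain ⟨hx, hy, A, hxA, hyA, hA⟩ := h
  refine ⟨fun hxy => inDifferentComponents_of_crossing hx hy hxA hyA fun u hu w hw huw => ?_,
    fun _ => inDifferentComponents_of_crossing hx hy hxA hyA fun u hu w hw huw => ?_⟩
  · rcases hA u hu w hw huw with h | h | ⟨rfl, rfl⟩
    exacts [Or.inl h, Or.inr h, absurd huw hxy]
  · rw [deleteEdges_adj] at huw
    rcases hA u hu w hw huw.1 with h | h | ⟨rfl, rfl⟩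
    exacts [Or.inl h, Or.inr h, absurd rfl huw.2]

theorem IsRainbow.subset {V C : Type*} {c : V → C} {S T : Set V} (h : IsRainbow c T)
    (hST : S ⊆ T) : IsRainbow c S := fun u hu v hv => h u (hST hu) v (hST hv)

theorem IsRainbow.congr {V C : Type*} {c c' : V → C} {S : Set V} (h : IsRainbow c' S)
    (hc : ∀ s ∈ S, c s = c' s) : IsRainbow c S := by
  intro u hu v hv huv
  rw [hc u hu, hc v hv]
  exact h u hu v hv huv

theorem IsRainbow.insert {V C : Type*} {c : V → C} {S : Set V} {x : V} (h : IsRainbow c S)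
    (hx : ∀ s ∈ S, c s ≠ c x) : IsRainbow c (insert x S) := by
  rintro u (rfl | hu) v (rfl | hv) huv
  · exact absurd rfl huv
  · exact (hx v hv).symm
  · exact hx u hu
  · exact h u hu v hv huv

theorem isRainbow_of_subsingleton {V C : Type*} {c : V → C} {S : Set V} (h : S.Subsingleton) :
    IsRainbow c S := fun _ hu _ hv huv => absurd (h hu hv) huv

theorem isRainbow_pair {V C : Type*} {c : V → C} {x y : V} (h : c x ≠ c y) :
    IsRainbow c {x, y} :=
  (isRainbow_of_subsingleton Set.subsingleton_singleton).insert fun s hs => by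
    rw [Set.mem_singleton_iff.1 hs]; exact h.symm

/-- The number of neighbors of a vertex, as a cardinality that needs no decidability instances. -/
noncomputable abbrev vdeg {V : Type*} (G : SimpleGraph V) (x : V) : ℕ := (G.neighborSet x).ncard

/-- `S` is a rainbow `x`-`y` vertex-cut which, for adjacent `x` and `y`, has fewer elements than
either of them has neighbors. -/
def HasCut {V C : Type*} (G : SimpleGraph V) (c : V → C) (x y : V) (S : Set V) : Prop :=
  G.Separates S x y ∧ IsRainbow c S ∧
    (G.Adj x y → (IsRainbow c (insert x S) ∨ IsRainbow c (insert y S)) ∧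
      S.ncard + 1 ≤ G.vdeg x ∧ S.ncard + 1 ≤ G.vdeg y)

theorem HasCut.symm {V C : Type*} {G : SimpleGraph V} {c : V → C} {x y : V} {S : Set V}
    (h : G.HasCut c x y S) : G.HasCut c y x S :=
  ⟨h.1.symm, h.2.1, fun hxy => ⟨(h.2.2 hxy.symm).1.symm, (h.2.2 hxy.symm).2.symm⟩⟩

/-- Any two vertices have a small rainbow cut, and the ends of every edge of `F` have different
colors. An edge of `F` stands for at least two parallel connections between its ends. -/
def IsStrongColoring {V C : Type*} (G F : SimpleGraph V) (c : V → C) : Prop :=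
  (∀ x y, F.Adj x y → c x ≠ c y) ∧ ∀ x y, x ≠ y → ∃ S, G.HasCut c x y S

theorem HasCut.isRainbowVertexCut {V C : Type*} {G : SimpleGraph V} {c : V → C} {x y : V}
    {S : Set V} (h : G.HasCut c x y S) : G.IsRainbowVertexCut c x y S :=
  ⟨h.1.isVertexCut, fun _ => h.2.1, fun hadj => (h.2.2 hadj).1⟩

/-- Isolated vertices are not needed in a cut. -/
theorem HasCut.exists_disjoint {V C : Type*} [Finite V] {G : SimpleGraph V} {c : V → C} {x y : V}
    {S : Set V} (h : G.HasCut c x y S) {W : Set V} (hW : ∀ w ∈ W, ∀ z, ¬ G.Adj w z) :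
    ∃ T, G.HasCut c x y T ∧ ∀ t ∈ T, t ∉ W := by
  obtain ⟨⟨hx, hy, A, hxA, hyA, hA⟩, hr, hadj⟩ := h
  have hsub : S \ W ⊆ S := Set.sdiff_subset
  refine ⟨S \ W, ⟨⟨fun h => hx h.1, fun h => hy h.1, A, hxA, hyA, fun u hu w hw huw => ?_⟩,
    hr.subset hsub, fun hxy => ?_⟩, fun t ht => ht.2⟩
  · rcases hA u hu w hw huw with h | h | h
    · exact Or.inl ⟨h, fun hu => hW u hu w huw⟩
    · exact Or.inr (Or.inl ⟨h, fun hw => hW w hw u huw.symm⟩)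
    · exact Or.inr (Or.inr h)
  · obtain ⟨h1, h2, h3⟩ := hadj hxy
    have hle := Set.ncard_le_ncard hsub
    exact ⟨h1.imp (fun h => h.subset (Set.insert_subset_insert hsub))
      fun h => h.subset (Set.insert_subset_insert hsub), by omega, by omega⟩

/-- The neighborhood of a vertex of degree two as a cut. -/
theorem hasCut_of_neighborSet_eq_pair {V C : Type*} {G : SimpleGraph V} {c : V → C} {v a b z : V}
    (hN : G.neighborSet v = {a, b}) (hc : c a ≠ c b) (hzv : z ≠ v) (hza : z ≠ a) (hzb : z ≠ b) :
    G.HasCut c v z {a, b} := by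
  have hmem : ∀ w, G.Adj v w ↔ w = a ∨ w = b := fun w => by
    rw [← mem_neighborSet, hN]; simp
  refine ⟨⟨?_, by simp [hza, hzb], {v}, rfl, hzv, ?_⟩, isRainbow_pair hc, fun h => ?_⟩
  · intro h
    exact G.irrefl ((hmem v).2 h)
  · rintro u rfl w - huw
    exact Or.inr (Or.inl ((hmem w).1 huw))
  · rcases (hmem z).1 h with h | h
    exacts [absurd h hza, absurd h hzb]

/-- The cut between a vertex of degree two and one of its neighbors consists of the other
neighbor. -/
theorem hasCut_neighbor {V C : Type*} {G : SimpleGraph V} {c : V → C} {v a b : V}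
    (hN : G.neighborSet v = {a, b}) (hab : a ≠ b) (hc : c v ≠ c b ∨ c a ≠ c b)
    (ha : 2 ≤ G.vdeg a) : G.HasCut c v a {b} := by
  have hmem : ∀ w, G.Adj v w ↔ w = a ∨ w = b := fun w => by
    rw [← mem_neighborSet, hN]; simp
  have hva := (hmem a).2 (Or.inl rfl)
  have hvb := (hmem b).2 (Or.inr rfl)
  refine ⟨⟨hvb.ne, hab, {v}, rfl, hva.ne', ?_⟩,
    isRainbow_of_subsingleton Set.subsingleton_singleton, fun _ =>
      ⟨hc.imp isRainbow_pair isRainbow_pair, ?_, ?_⟩⟩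
  · rintro u rfl w - huw
    rcases (hmem w).1 huw with h | h
    exacts [Or.inr (Or.inr ⟨rfl, h⟩), Or.inr (Or.inl h)]
  · rw [vdeg, hN, Set.ncard_pair hab, Set.ncard_singleton]
  · rwa [Set.ncard_singleton]

theorem exists_hasCut_of_neighborSet_eq_pair {V C : Type*} {G : SimpleGraph V} {c : V → C}
    {v a b : V} (hN : G.neighborSet v = {a, b}) (hc : c a ≠ c b) (ha : 2 ≤ G.vdeg a)
    (hb : 2 ≤ G.vdeg b) {z : V} (hz : z ≠ v) : ∃ S, G.HasCut c v z S := by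
  have hab : a ≠ b := fun h => hc (h ▸ rfl)
  by_cases hza : z = a
  · subst hza
    exact ⟨_, hasCut_neighbor hN hab (Or.inr hc) ha⟩
  · by_cases hzb : z = b
    · subst hzb
      exact ⟨_, hasCut_neighbor (hN.trans (Set.pair_comm _ _)) hab.symm (Or.inr hc.symm) hb⟩
    · exact ⟨_, hasCut_of_neighborSet_eq_pair hN hc hz hza hzb⟩

/-! ### Replacing a part of the graph by an edge -/

/-- All vertices of `W` are made isolated, and `a` and `b` are made adjacent if they differ. -/
def reduce {V : Type*} (G : SimpleGraph V) (W : Set V) (a b : V) : SimpleGraph V where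
  Adj x y := (x ∉ W ∧ y ∉ W ∧ G.Adj x y) ∨ (a ≠ b ∧ (x = a ∧ y = b ∨ x = b ∧ y = a))
  symm := ⟨by
    rintro x y (⟨h1, h2, h3⟩ | ⟨h, h1⟩)
    · exact Or.inl ⟨h2, h1, h3.symm⟩
    · exact Or.inr ⟨h, by tauto⟩⟩
  loopless := ⟨by
    rintro x (⟨-, -, h⟩ | ⟨h, ⟨rfl, rfl⟩ | ⟨rfl, rfl⟩⟩)
    · exact G.irrefl h
    · exact h rfl
    · exact h rfl⟩

theorem reduce_comm {V : Type*} (G : SimpleGraph V) (W : Set V) (a b : V) :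
    G.reduce W a b = G.reduce W b a := by
  ext x y
  simp only [reduce]
  tauto

theorem reduce_adj_self {V : Type*} {G : SimpleGraph V} {W : Set V} {a b : V} (hab : a ≠ b) :
    (G.reduce W a b).Adj a b := Or.inr ⟨hab, Or.inl ⟨rfl, rfl⟩⟩

theorem reduce_mono {V : Type*} {F G : SimpleGraph V} (h : F ≤ G) (W : Set V) (a b : V) :
    F.reduce W a b ≤ G.reduce W a b := by
  rintro x y (⟨h1, h2, h3⟩ | h')
  exacts [Or.inl ⟨h1, h2, h h3⟩, Or.inr h']

theorem reduce_self_le {V : Type*} (G : SimpleGraph V) (W : Set V) (a b p : V) :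
    G.reduce W p p ≤ G.reduce W a b := by
  rintro x y (h | ⟨h, -⟩)
  exacts [Or.inl h, absurd rfl h]

theorem reduce_le {V : Type*} {G : SimpleGraph V} {W : Set V} {a b : V} (h : a = b ∨ G.Adj a b) :
    G.reduce W a b ≤ G := by
  rintro x y (⟨-, -, h'⟩ | ⟨h1, ⟨rfl, rfl⟩ | ⟨rfl, rfl⟩⟩)
  · exact h'
  · exact h.resolve_left h1
  · exact (h.resolve_left h1).symm

theorem not_reduce_adj {V : Type*} {G : SimpleGraph V} {W : Set V} {a b w : V} (ha : a ∉ W)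
    (hb : b ∉ W) (hw : w ∈ W) (z : V) : ¬ (G.reduce W a b).Adj w z := by
  rintro (⟨h, -, -⟩ | ⟨-, ⟨rfl, -⟩ | ⟨rfl, -⟩⟩)
  exacts [h hw, ha hw, hb hw]

theorem vdeg_reduce_le {V : Type*} [Finite V] (G : SimpleGraph V) (W : Set V) {a b x : V}
    (ha : a = b ∨ x ≠ a) (hb : a = b ∨ x ≠ b) : (G.reduce W a b).vdeg x ≤ G.vdeg x := by
  refine Set.ncard_le_ncard ?_
  rintro z (⟨-, -, h⟩ | ⟨hne, ⟨h, -⟩ | ⟨h, -⟩⟩)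
  · exact h
  · exact absurd h (ha.resolve_left hne)
  · exact absurd h (hb.resolve_left hne)

theorem vdeg_reduce_add_le {V : Type*} [Finite V] {G : SimpleGraph V} {W : Set V} {a : V} (b : V)
    {T : Set V} (hT : T ⊆ W) (hTa : ∀ t ∈ T, G.Adj a t) :
    (G.reduce W a b).vdeg a + T.ncard ≤ G.vdeg a + 1 := by
  have hsub : (G.reduce W a b).neighborSet a ⊆ insert b (G.neighborSet a \ T) := by
    rintro z (⟨-, h2, h⟩ | ⟨-, ⟨-, h⟩ | ⟨h, h'⟩⟩)
    · exact Or.inr ⟨h, fun hz => h2 (hT hz)⟩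
    · exact Or.inl h
    · exact Or.inl (h'.trans h)
  have h1 := Set.ncard_le_ncard hsub
  have h2 := Set.ncard_insert_le b (G.neighborSet a \ T)
  have h3 := Set.ncard_sdiff_add_ncard_of_subset (s := T) (t := G.neighborSet a) hTa
  simp only [vdeg]
  omega

theorem vdeg_reduce_add_le_of_adj {V : Type*} [Finite V] {G : SimpleGraph V} {W : Set V} {a b : V}
    {T : Set V} (hT : T ⊆ W) (hTa : ∀ t ∈ T, G.Adj a t) (hab : a = b ∨ G.Adj a b) (hb : b ∉ W) :
    (G.reduce W a b).vdeg a + T.ncard ≤ G.vdeg a := by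
  have hsub : (G.reduce W a b).neighborSet a ⊆ G.neighborSet a \ T := by
    rintro z (⟨-, h2, h⟩ | ⟨hne, ⟨-, rfl⟩ | ⟨h, rfl⟩⟩)
    · exact ⟨h, fun hz => h2 (hT hz)⟩
    · exact ⟨hab.resolve_left hne, fun hz => hb (hT hz)⟩
    · exact absurd h hne
  have h1 := Set.ncard_le_ncard hsub
  have h3 := Set.ncard_sdiff_add_ncard_of_subset (s := T) (t := G.neighborSet a) hTa
  simp only [vdeg]
  omega

/-- A cut of the reduced graph between two vertices other than the pair `a`, `b` remains a cut in
`G`: all of `W` is put on the side of `a`, or of `b`, since a path through `W` can be replaced by the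
edge `ab`. -/
theorem HasCut.of_reduce {V C : Type*} [Finite V] {G : SimpleGraph V} {W : Set V} {a b : V}
    {c c' : V → C} (hW : ∀ w ∈ W, ∀ z, G.Adj w z → z ∈ W ∨ z = a ∨ z = b) (ha : a ∉ W) (hb : b ∉ W)
    (hdeg : ∀ x ∉ W, (G.reduce W a b).vdeg x ≤ G.vdeg x) (hc : ∀ x ∉ W, c x = c' x) {x y : V}
    (hx : x ∉ W) (hy : y ∉ W) (hxy : ¬ (x = a ∧ y = b)) (hyx : ¬ (x = b ∧ y = a)) {S : Set V}
    (h : (G.reduce W a b).HasCut c' x y S) : ∃ T, G.HasCut c x y T := by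
  obtain ⟨S, ⟨⟨hxS, hyS, A, hxA, hyA, hA⟩, hr, hadj⟩, hSW⟩ :=
    h.exists_disjoint fun w hw z => not_reduce_adj ha hb hw z
  have hins : ∀ {z}, z ∉ W → IsRainbow c' (insert z S) → IsRainbow c (insert z S) := by
    intro z hz h
    refine h.congr fun s hs => hc s ?_
    rcases hs with rfl | hs
    exacts [hz, hSW s hs]
  refine ⟨S, ⟨hxS, hyS,
    {u | u ∉ W ∧ u ∈ A ∨ u ∈ W ∧ (a ∈ A ∧ a ∉ S ∨ b ∈ A ∧ b ∉ S)}, Or.inl ⟨hx, hxA⟩, ?_, ?_⟩,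
    hr.congr fun s hs => hc s (hSW s hs), fun hG => ?_⟩
  · rintro (⟨-, h⟩ | ⟨h, -⟩)
    exacts [hyA h, hy h]
  · -- an edge between `a` and `b` crosses `A` only if it meets `S`
    have hedge : (a ∈ A ∧ a ∉ S ∨ b ∈ A ∧ b ∉ S) → (a ∈ A ∨ a ∈ S) ∧ (b ∈ A ∨ b ∈ S) := by
      rintro (⟨h1, h2⟩ | ⟨h1, h2⟩)
      · refine ⟨Or.inl h1, ?_⟩
        by_contra! h
        have hne : a ≠ b := fun h' => h.1 (h' ▸ h1)
        rcases hA a h1 b h.1 (reduce_adj_self hne) with h' | h' | ⟨h', h''⟩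
        exacts [h2 h', h.2 h', hxy ⟨h'.symm, h''.symm⟩]
      · refine ⟨?_, Or.inl h1⟩
        by_contra! h
        have hne : a ≠ b := fun h' => h.1 (h' ▸ h1)
        rcases hA b h1 a h.1 (reduce_adj_self hne).symm with h' | h' | ⟨h', h''⟩
        exacts [h2 h', h.2 h', hyx ⟨h'.symm, h''.symm⟩]
    rintro u (⟨hu, huA⟩ | ⟨hu, hu'⟩) w hw huw
    · by_cases hwW : w ∈ W
      · rcases hW w hwW u huw.symm with h | rfl | rfl
        · exact absurd h hu
        · exact Or.inl (by_contra fun h => hw (Or.inr ⟨hwW, Or.inl ⟨huA, h⟩⟩))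
        · exact Or.inl (by_contra fun h => hw (Or.inr ⟨hwW, Or.inr ⟨huA, h⟩⟩))
      · exact hA u huA w (fun h => hw (Or.inl ⟨hwW, h⟩)) (Or.inl ⟨hu, hwW, huw⟩)
    · have hwW : w ∉ W := fun h => hw (Or.inr ⟨h, hu'⟩)
      have hwA : w ∉ A := fun h => hw (Or.inl ⟨hwW, h⟩)
      obtain ⟨h1, h2⟩ := hedge hu'
      rcases hW u hu w huw with h | rfl | rfl
      · exact absurd h hwW
      · exact Or.inr (Or.inl (h1.resolve_left hwA))
      · exact Or.inr (Or.inl (h2.resolve_left hwA))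
  · obtain ⟨h1, h2, h3⟩ := hadj (Or.inl ⟨hx, hy, hG⟩)
    exact ⟨h1.imp (hins hx) (hins hy), h2.trans (hdeg x hx), h3.trans (hdeg y hy)⟩

/-- A cut between `a` and `b` in the reduced graph becomes one in `G` if it is enlarged by all
vertices of `W` that have other neighbors outside of `W` than `b`. -/
theorem Separates.of_reduce {V : Type*} {G : SimpleGraph V} {W : Set V} {a b : V} {S T : Set V}
    (ha : a ∉ W) (h : (G.reduce W a b).Separates S a b) (hST : S ⊆ T)
    (haT : a ∉ T) (hbT : b ∉ T) (hW : ∀ w ∈ W, w ∈ T ∨ ∀ z ∉ W, G.Adj w z → z = b) :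
    G.Separates T a b := by
  obtain ⟨-, -, A, haA, hbA, hA⟩ := h
  refine ⟨haT, hbT, A \ W, ⟨haA, ha⟩, fun h => hbA h.1, fun u hu w hw huw => ?_⟩
  by_cases hwW : w ∈ W
  · rcases hW w hwW with h | h
    · exact Or.inr (Or.inl h)
    · exact absurd hu.1 (h u hu.2 huw.symm ▸ hbA)
  · rcases hA u hu.1 w (fun h => hw ⟨h, hwW⟩) (Or.inl ⟨hu.2, hwW, huw⟩) with h | h | h
    exacts [Or.inl (hST h), Or.inr (Or.inl (hST h)), Or.inr (Or.inr h)]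

/-- To extend a coloring of the reduced graph to `W`, only the pairs that meet `W` and the pair
`a`, `b` have to be considered. -/
theorem IsStrongColoring.of_reduce {V C : Type*} [Finite V] {G F F' : SimpleGraph V} {W : Set V}
    {a b : V} {c c' : V → C} (h : (G.reduce W a b).IsStrongColoring F' c')
    (hF' : F.reduce W a a ≤ F')
    (hW : ∀ w ∈ W, ∀ z, G.Adj w z → z ∈ W ∨ z = a ∨ z = b) (ha : a ∉ W) (hb : b ∉ W)
    (hdeg : ∀ x ∉ W, (G.reduce W a b).vdeg x ≤ G.vdeg x) (hc : ∀ x ∉ W, c x = c' x)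
    (hcF : ∀ w ∈ W, ∀ z, F.Adj w z → c w ≠ c z)
    (hcW : ∀ w ∈ W, ∀ z, z ≠ w → ∃ S, G.HasCut c w z S)
    (hab : a ≠ b → ∃ S, G.HasCut c a b S) : G.IsStrongColoring F c := by
  refine ⟨fun x y hxy => ?_, fun x y hxy => ?_⟩
  · by_cases hx : x ∈ W
    · exact hcF x hx y hxy
    by_cases hy : y ∈ W
    · exact (hcF y hy x hxy.symm).symm
    rw [hc x hx, hc y hy]
    exact h.1 x y (hF' (Or.inl ⟨hx, hy, hxy⟩))
  · by_cases hx : x ∈ W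
    · exact hcW x hx y hxy.symm
    by_cases hy : y ∈ W
    · exact (hcW y hy x hxy).imp fun S => HasCut.symm
    by_cases h1 : x = a ∧ y = b
    · obtain ⟨rfl, rfl⟩ := h1
      exact hab hxy
    by_cases h2 : x = b ∧ y = a
    · obtain ⟨rfl, rfl⟩ := h2
      exact (hab hxy.symm).imp fun S => HasCut.symm
    obtain ⟨S, hS⟩ := h.2 x y hxy
    exact HasCut.of_reduce hW ha hb hdeg hc hx hy h1 h2 hS

/-- There is a color outside of a list that does not occur on a set. -/
theorem exists_color {V : Type*} [Finite V] {k : ℕ} (c : V → Fin k) (S : Set V) (L : List (Fin k))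
    (h : S.ncard + L.length < k) : ∃ t, (∀ s ∈ S, c s ≠ t) ∧ ∀ l ∈ L, t ≠ l := by
  classical
  have h1 : (c '' S ∪ {l | l ∈ L}).ncard < k := by
    have h2 := Set.ncard_union_le (c '' S) {l | l ∈ L}
    have h3 := Set.ncard_image_le (f := c) (Set.toFinite S)
    have h4 : {l | l ∈ L}.ncard ≤ L.length := by
      have : {l | l ∈ L} = (L.toFinset : Set (Fin k)) := by ext; simp
      rw [this, Set.ncard_coe_finset]
      exact L.toFinset_card_le
    omega
  obtain ⟨t, ht⟩ : ∃ t, t ∉ c '' S ∪ {l | l ∈ L} := by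
    by_contra! hall
    rw [Set.eq_univ_of_forall hall, Set.ncard_univ, Nat.card_eq_fintype_card,
      Fintype.card_fin] at h1
    exact lt_irrefl _ h1
  exact ⟨t, fun s hs h => ht (Or.inl ⟨s, hs, h⟩), fun l hl h => ht (Or.inr (h ▸ hl))⟩

/-! ### Extending colorings -/

theorem adj_iff_of_neighborSet_eq_pair {V : Type*} {G : SimpleGraph V} {v a b : V}
    (hN : G.neighborSet v = {a, b}) (w : V) : G.Adj v w ↔ w = a ∨ w = b := by
  rw [← mem_neighborSet, hN]; simp

/-- A coloring extends to a vertex of degree one: any color other than that of the neighbor will do,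
since the empty set and the neighbor are the cuts that are needed. -/
theorem IsStrongColoring.exists_of_pendant {V : Type*} [Finite V] {G F : SimpleGraph V}
    {v a : V} {k : ℕ} (hk : 3 ≤ k) (hFG : F ≤ G) (hN : G.neighborSet v = {a}) {c' : V → Fin k}
    (h : (G.reduce {v} a a).IsStrongColoring (F.reduce {v} a a) c') :
    ∃ c : V → Fin k, G.IsStrongColoring F c := by
  classical
  have hmem : ∀ w, G.Adj v w ↔ w = a := fun w => by rw [← mem_neighborSet, hN]; simp
  have hva : G.Adj v a := (hmem a).2 rfl
  obtain ⟨t, -, ht⟩ := exists_color c' ∅ [c' a] (by simp; omega)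
  have ha : a ∉ ({v} : Set V) := hva.ne'
  refine ⟨Function.update c' v t, h.of_reduce (W := {v}) (a := a) (b := a) le_rfl ?_ ha ha ?_ ?_ ?_
    ?_ fun h => absurd rfl h⟩
  · rintro w rfl z hz
    exact Or.inr (Or.inl ((hmem z).1 hz))
  · exact fun x _ => vdeg_reduce_le G _ (Or.inl rfl) (Or.inl rfl)
  · exact fun x hx => Function.update_of_ne hx _ _
  · rintro w rfl z hz
    obtain rfl := (hmem z).1 (hFG hz)
    rw [Function.update_self, Function.update_of_ne hva.ne']
    exact ht _ (by simp)
  · rintro w rfl z hz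
    by_cases hza : z = a
    · subst hza
      refine ⟨∅, ⟨by simp, by simp, {w}, rfl, hz, ?_⟩,
        isRainbow_of_subsingleton Set.subsingleton_empty, fun _ =>
          ⟨Or.inl (isRainbow_of_subsingleton (by simp)), ?_, ?_⟩⟩
      · rintro u rfl y - huy
        exact Or.inr (Or.inr ⟨rfl, (hmem y).1 huy⟩)
      · simp [vdeg, hN]
      · rw [Set.ncard_empty]
        exact (Set.ncard_pos).2 ⟨w, hva.symm⟩
    · refine ⟨{a}, ⟨hva.ne, hza, {w}, rfl, hz, ?_⟩,
        isRainbow_of_subsingleton Set.subsingleton_singleton,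
        fun h => absurd ((hmem z).1 h) hza⟩
      rintro u rfl y - huy
      exact Or.inr (Or.inl ((hmem y).1 huy))

/-- A coloring extends to a vertex `v` of degree two with adjacent neighbors `a` and `b`. In the
reduced graph the edge `ab` is marked, so that `{a, b}` is rainbow; the color of `v` is chosen such
that `v` can be added to the cut between `a` and `b`. -/
theorem IsStrongColoring.exists_of_triangle {V : Type*} [Finite V] {G F : SimpleGraph V}
    {v a b : V} {k : ℕ} (hFG : F ≤ G) (hdegk : ∀ x, G.vdeg x + F.vdeg x ≤ k)
    (hN : G.neighborSet v = {a, b}) (hab : G.Adj a b) {c' : V → Fin k}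
    (h : (G.reduce {v} a b).IsStrongColoring (F.reduce {v} a b) c') :
    ∃ c : V → Fin k, G.IsStrongColoring F c := by
  classical
  have hmem := adj_iff_of_neighborSet_eq_pair hN
  have hva : G.Adj v a := (hmem a).2 (Or.inl rfl)
  have hvb : G.Adj v b := (hmem b).2 (Or.inr rfl)
  have ha : a ∉ ({v} : Set V) := hva.ne'
  have hb : b ∉ ({v} : Set V) := hvb.ne'
  have hcab : c' a ≠ c' b := h.1 a b (reduce_adj_self hab.ne)
  obtain ⟨S, ⟨hsep, hr, hS⟩, hSv⟩ := (h.2 a b hab.ne).choose_spec.exists_disjoint (W := {v})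
    fun w hw z => not_reduce_adj ha hb hw z
  obtain ⟨hrab, hSa, hSb⟩ := hS (reduce_adj_self hab.ne)
  have hda := vdeg_reduce_add_le_of_adj (G := G) (W := {v}) (a := a) (b := b) (T := {v}) subset_rfl
    (by rintro t rfl; exact hva.symm) (Or.inr hab) hb
  have hdb := vdeg_reduce_add_le_of_adj (G := G) (W := {v}) (a := b) (b := a) (T := {v}) subset_rfl
    (by rintro t rfl; exact hvb.symm) (Or.inr hab.symm) ha
  rw [reduce_comm] at hdb
  rw [Set.ncard_singleton] at hda hdb
  have hka := hdegk a
  have hkb := hdegk b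
  have hFpos : ∀ p, F.Adj v p → 1 ≤ F.vdeg p := fun p hp => (Set.ncard_pos).2 ⟨v, hp.symm⟩
  -- the new color avoids the cut between `a` and `b` together with one of the two vertices
  obtain ⟨t, htS, hta, htb, ht⟩ : ∃ t, (∀ s ∈ S, c' s ≠ t) ∧ (F.Adj v a → t ≠ c' a) ∧
      (F.Adj v b → t ≠ c' b) ∧
      (IsRainbow c' (insert a S) ∧ t ≠ c' a ∨ IsRainbow c' (insert b S) ∧ t ≠ c' b) := by
    rcases hrab with hr' | hr'
    · by_cases hF : F.Adj v b
      · obtain ⟨t, ht, htL⟩ := exists_color c' S [c' a, c' b] (by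
          have := hFpos b hF; simp; omega)
        exact ⟨t, ht, fun _ => htL _ (by simp), fun _ => htL _ (by simp),
          Or.inl ⟨hr', htL _ (by simp)⟩⟩
      · obtain ⟨t, ht, htL⟩ := exists_color c' S [c' a] (by simp; omega)
        exact ⟨t, ht, fun _ => htL _ (by simp), fun h => absurd h hF,
          Or.inl ⟨hr', htL _ (by simp)⟩⟩
    · by_cases hF : F.Adj v a
      · obtain ⟨t, ht, htL⟩ := exists_color c' S [c' a, c' b] (by
          have := hFpos a hF; simp; omega)
        exact ⟨t, ht, fun _ => htL _ (by simp), fun _ => htL _ (by simp),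
          Or.inr ⟨hr', htL _ (by simp)⟩⟩
      · obtain ⟨t, ht, htL⟩ := exists_color c' S [c' b] (by simp; omega)
        exact ⟨t, ht, fun h => absurd h hF, fun _ => htL _ (by simp),
          Or.inr ⟨hr', htL _ (by simp)⟩⟩
  set c := Function.update c' v t with hc
  have hcv : c v = t := Function.update_self ..
  have hcne : ∀ x, x ≠ v → c x = c' x := fun x hx => Function.update_of_ne hx _ _
  have hcut : ∀ p, p ≠ v → IsRainbow c' (insert p S) → t ≠ c' p →
      IsRainbow c (insert p (insert v S)) := by
    intro p hp hr' hne
    rw [Set.insert_comm]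
    refine (hr'.congr fun s hs => hcne s ?_).insert ?_
    · rcases hs with rfl | hs
      exacts [hp, hSv s hs]
    · rintro s (rfl | hs)
      · rw [hcv, hcne _ hp]; exact hne.symm
      · rw [hcv, hcne _ (hSv s hs)]; exact htS s hs
  have h2a : 2 ≤ G.vdeg a := by omega
  have h2b : 2 ≤ G.vdeg b := by omega
  refine ⟨c, h.of_reduce (W := {v}) (a := a) (b := b) (reduce_self_le _ _ _ _ _) ?_ ha hb
    (fun x _ => Set.ncard_le_ncard (reduce_le (Or.inr hab) (v := x)))
    (fun x hx => hcne x hx) ?_ ?_ fun _ => ?_⟩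
  · rintro w rfl z hz
    exact Or.inr ((hmem z).1 hz)
  · rintro w rfl z hz
    rcases (hmem z).1 (hFG hz) with rfl | rfl
    · rw [hcv, hcne _ hva.ne']; exact hta hz
    · rw [hcv, hcne _ hvb.ne']; exact htb hz
  · rintro w rfl z hz
    refine exists_hasCut_of_neighborSet_eq_pair hN ?_ h2a h2b hz
    rwa [hcne _ hva.ne', hcne _ hvb.ne']
  · have hle := Set.ncard_insert_le v S
    refine ⟨insert v S, hsep.of_reduce ha (Set.subset_insert _ _) ?_ ?_ ?_, ?_, fun _ =>
      ⟨?_, by omega, by omega⟩⟩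
    · rintro (h | h)
      exacts [ha h, hsep.1 h]
    · rintro (h | h)
      exacts [hb h, hsep.2.1 h]
    · rintro w rfl
      exact Or.inl (Or.inl rfl)
    · rcases ht with ⟨h1, h2⟩ | ⟨h1, h2⟩
      · exact (hcut a ha h1 h2).subset (Set.subset_insert _ _)
      · exact (hcut b hb h1 h2).subset (Set.subset_insert _ _)
    · exact ht.imp (fun h => hcut a ha h.1 h.2) fun h => hcut b hb h.1 h.2

/-- A coloring extends to two vertices `v`, `v'` of degree two with the same two nonadjacent
neighbors `a` and `b`. Both are added to the cut between `a` and `b`; as these are nonadjacent in `G`, the new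
cut need not stay rainbow together with `a` or `b`. -/
theorem IsStrongColoring.exists_of_twins {V : Type*} [Finite V] {G F : SimpleGraph V}
    {v v' a b : V} {k : ℕ} (hFG : F ≤ G) (hdegk : ∀ x, G.vdeg x + F.vdeg x ≤ k) (hvv : v ≠ v')
    (hab : a ≠ b) (hN : G.neighborSet v = {a, b}) (hN' : G.neighborSet v' = {a, b})
    (hnab : ¬ G.Adj a b) {c' : V → Fin k}
    (h : (G.reduce {v, v'} a b).IsStrongColoring (F.reduce {v, v'} a b) c') :
    ∃ c : V → Fin k, G.IsStrongColoring F c := by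
  classical
  have hmem := adj_iff_of_neighborSet_eq_pair hN
  have hmem' := adj_iff_of_neighborSet_eq_pair hN'
  have hva : G.Adj v a := (hmem a).2 (Or.inl rfl)
  have hvb : G.Adj v b := (hmem b).2 (Or.inr rfl)
  have hva' : G.Adj v' a := (hmem' a).2 (Or.inl rfl)
  have hvb' : G.Adj v' b := (hmem' b).2 (Or.inr rfl)
  have ha : a ∉ ({v, v'} : Set V) := by simp [hva.ne', hva'.ne']
  have hb : b ∉ ({v, v'} : Set V) := by simp [hvb.ne', hvb'.ne']
  have hcab : c' a ≠ c' b := h.1 a b (reduce_adj_self hab)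
  obtain ⟨S, ⟨hsep, hr, hS⟩, hSv⟩ := (h.2 a b hab).choose_spec.exists_disjoint (W := {v, v'})
    fun w hw z => not_reduce_adj ha hb hw z
  obtain ⟨hrab, hSa, hSb⟩ := hS (reduce_adj_self hab)
  have hda := vdeg_reduce_add_le (G := G) (W := {v, v'}) (a := a) b (T := {v, v'}) subset_rfl
    (by rintro t (rfl | rfl) <;> exact Adj.symm ‹_›)
  have hdb := vdeg_reduce_add_le (G := G) (W := {v, v'}) (a := b) a (T := {v, v'}) subset_rfl
    (by rintro t (rfl | rfl) <;> exact Adj.symm ‹_›)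
  rw [reduce_comm] at hdb
  rw [Set.ncard_pair hvv] at hda hdb
  have hka := hdegk a
  have hkb := hdegk b
  have hFpos : ∀ p, F.Adj v p ∨ F.Adj v' p → 1 ≤ F.vdeg p := by
    rintro p (hp | hp)
    exacts [(Set.ncard_pos).2 ⟨v, hp.symm⟩, (Set.ncard_pos).2 ⟨v', hp.symm⟩]
  have hFtwo : ∀ p, F.Adj v p → F.Adj v' p → 2 ≤ F.vdeg p := by
    intro p hp hp'
    rw [← Set.ncard_pair hvv]
    refine Set.ncard_le_ncard ?_
    rintro x (rfl | rfl)
    exacts [hp.symm, hp'.symm]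
  -- If the cut `S` misses the color of `p`, then `p` can be used for a vertex not joined to `p`
  -- by an edge of `F`; if both are, there are two more colors anyway.
  have key : ∀ p q, (∀ s ∈ S, c' s ≠ c' p) → c' p ≠ c' q → S.ncard + 2 + F.vdeg p ≤ k →
      S.ncard + 2 + F.vdeg q ≤ k → ∃ t t', t ≠ t' ∧ (∀ s ∈ S, c' s ≠ t) ∧ (∀ s ∈ S, c' s ≠ t') ∧
        (F.Adj v p → t ≠ c' p) ∧ (F.Adj v q → t ≠ c' q) ∧
        (F.Adj v' p → t' ≠ c' p) ∧ (F.Adj v' q → t' ≠ c' q) := by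
    intro p q hpS hpq hkp hkq
    by_cases hvp : F.Adj v p
    · by_cases hvp' : F.Adj v' p
      · have := hFtwo p hvp hvp'
        obtain ⟨t, ht, htL⟩ := exists_color c' S [c' p, c' q] (by simp; omega)
        obtain ⟨t', ht', htL'⟩ := exists_color c' S [t, c' p, c' q] (by simp; omega)
        exact ⟨t, t', (htL' _ (by simp)).symm, ht, ht', fun _ => htL _ (by simp),
          fun _ => htL _ (by simp), fun _ => htL' _ (by simp), fun _ => htL' _ (by simp)⟩
      · by_cases hvq : F.Adj v q
        · have := hFpos q (Or.inl hvq)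
          obtain ⟨t, ht, htL⟩ := exists_color c' S [c' p, c' q] (by simp; omega)
          exact ⟨t, c' p, htL _ (by simp), ht, hpS, fun _ => htL _ (by simp),
            fun _ => htL _ (by simp), fun h => absurd h hvp', fun _ => hpq⟩
        · obtain ⟨t, ht, htL⟩ := exists_color c' S [c' p] (by simp; omega)
          exact ⟨t, c' p, htL _ (by simp), ht, hpS, fun _ => htL _ (by simp),
            fun h => absurd h hvq, fun h => absurd h hvp', fun _ => hpq⟩
    · by_cases hvq' : F.Adj v' q
      · have := hFpos q (Or.inr hvq')
        obtain ⟨t, ht, htL⟩ := exists_color c' S [c' p, c' q] (by simp; omega)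
        exact ⟨c' p, t, (htL _ (by simp)).symm, hpS, ht, fun h => absurd h hvp, fun _ => hpq,
          fun _ => htL _ (by simp), fun _ => htL _ (by simp)⟩
      · obtain ⟨t, ht, htL⟩ := exists_color c' S [c' p] (by simp; omega)
        exact ⟨c' p, t, (htL _ (by simp)).symm, hpS, ht, fun h => absurd h hvp, fun _ => hpq,
          fun _ => htL _ (by simp), fun h => absurd h hvq'⟩
  obtain ⟨t, t', htt, htS, htS', hta, htb, hta', htb'⟩ : ∃ t t', t ≠ t' ∧ (∀ s ∈ S, c' s ≠ t) ∧
      (∀ s ∈ S, c' s ≠ t') ∧ (F.Adj v a → t ≠ c' a) ∧ (F.Adj v b → t ≠ c' b) ∧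
        (F.Adj v' a → t' ≠ c' a) ∧ (F.Adj v' b → t' ≠ c' b) := by
    have hmiss : ∀ p, p ∉ S → IsRainbow c' (insert p S) → ∀ s ∈ S, c' s ≠ c' p :=
      fun p hp hr' s hs => hr' s (Or.inr hs) p (Or.inl rfl) fun h => hp (h ▸ hs)
    rcases hrab with hr' | hr'
    · exact key a b (hmiss a hsep.1 hr') hcab (by omega) (by omega)
    · obtain ⟨t, t', h1, h2, h3, h4, h5, h6, h7⟩ :=
        key b a (hmiss b hsep.2.1 hr') hcab.symm (by omega) (by omega)
      exact ⟨t, t', h1, h2, h3, h5, h4, h7, h6⟩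
  set c := Function.update (Function.update c' v t) v' t' with hc
  have hcv' : c v' = t' := Function.update_self ..
  have hcv : c v = t := by rw [hc, Function.update_of_ne hvv, Function.update_self]
  have hcne : ∀ x ∉ ({v, v'} : Set V), c x = c' x := fun x hx => by
    simp only [Set.mem_insert_iff, Set.mem_singleton_iff, not_or] at hx
    rw [hc, Function.update_of_ne hx.2, Function.update_of_ne hx.1]
  have hca := hcne a ha
  have hcb := hcne b hb
  have h2a : 2 ≤ G.vdeg a := by omega
  have h2b : 2 ≤ G.vdeg b := by omega
  refine ⟨c, h.of_reduce (W := {v, v'}) (a := a) (b := b) (reduce_self_le _ _ _ _ _) ?_ ha hb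
    (fun x _ => ?_) hcne ?_ ?_ fun _ => ?_⟩
  · rintro w (rfl | rfl) z hz
    exacts [Or.inr ((hmem z).1 hz), Or.inr ((hmem' z).1 hz)]
  · by_cases hxa : x = a
    · rw [hxa]; omega
    by_cases hxb : x = b
    · rw [hxb]; omega
    exact vdeg_reduce_le G _ (Or.inr hxa) (Or.inr hxb)
  · rintro w (rfl | rfl) z hz
    · rcases (hmem z).1 (hFG hz) with rfl | rfl
      · rw [hcv, hca]; exact hta hz
      · rw [hcv, hcb]; exact htb hz
    · rcases (hmem' z).1 (hFG hz) with rfl | rfl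
      · rw [hcv', hca]; exact hta' hz
      · rw [hcv', hcb]; exact htb' hz
  · rintro w (rfl | rfl) z hz
    · exact exists_hasCut_of_neighborSet_eq_pair hN (by rwa [hca, hcb]) h2a h2b hz
    · exact exists_hasCut_of_neighborSet_eq_pair hN' (by rwa [hca, hcb]) h2a h2b hz
  · refine ⟨insert v (insert v' S), hsep.of_reduce ha
      ((Set.subset_insert _ _).trans (Set.subset_insert _ _)) ?_ ?_ ?_, ?_, fun h => absurd h hnab⟩
    · rintro (h | h | h)
      exacts [hva.ne' h, hva'.ne' h, hsep.1 h]
    · rintro (h | h | h)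
      exacts [hvb.ne' h, hvb'.ne' h, hsep.2.1 h]
    · rintro w (rfl | rfl)
      exacts [Or.inl (Or.inl rfl), Or.inl (Or.inr (Or.inl rfl))]
    · refine ((hr.congr fun s hs => hcne s (hSv s hs)).insert fun s hs => ?_).insert ?_
      · rw [hcv', hcne s (hSv s hs)]; exact htS' s hs
      · rintro s (rfl | hs)
        · rw [hcv, hcv']; exact htt.symm
        · rw [hcv, hcne s (hSv s hs)]; exact htS s hs

/-- A cut between a neighbor `a` of a vertex `v` of degree two and a vertex `z`, in the graph where
`v` is suppressed, also separates `v` from `z`. -/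
theorem HasCut.of_subdivision {V C : Type*} [Finite V] {G : SimpleGraph V} {v a b z : V}
    {c c' : V → C} (hN : G.neighborSet v = {a, b}) (hab : a ≠ b) (hzv : z ≠ v) (hza : z ≠ a)
    (hzb : z ≠ b) (hc : ∀ x ≠ v, c x = c' x) {S : Set V}
    (h : (G.reduce {v} a b).HasCut c' a z S) (hadj : ¬ (G.reduce {v} a b).Adj a z) :
    ∃ T, G.HasCut c v z T := by
  have hmem := adj_iff_of_neighborSet_eq_pair hN
  have ha : a ∉ ({v} : Set V) := ((hmem a).2 (Or.inl rfl)).ne'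
  have hb : b ∉ ({v} : Set V) := ((hmem b).2 (Or.inr rfl)).ne'
  obtain ⟨S, ⟨⟨haS, hzS, A, haA, hzA, hA⟩, hr, -⟩, hSv⟩ :=
    h.exists_disjoint fun w hw z => not_reduce_adj ha hb hw z
  have hA' : ∀ u ∈ A, ∀ w ∉ A, (G.reduce {v} a b).Adj u w → u ∈ S ∨ w ∈ S := by
    intro u hu w hw huw
    rcases hA u hu w hw huw with h | h | ⟨rfl, rfl⟩
    exacts [Or.inl h, Or.inr h, absurd huw hadj]
  refine ⟨S, ⟨fun h => hSv v h rfl, hzS, insert v A, Or.inl rfl, ?_, ?_⟩,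
    hr.congr fun s hs => hc s (hSv s hs), fun h => ?_⟩
  · rintro (h | h)
    exacts [hzv h, hzA h]
  · intro u hu w hw huw
    have hwv : w ≠ v := fun h => hw (Or.inl h)
    have hwA : w ∉ A := fun h => hw (Or.inr h)
    by_cases huv : u = v
    · subst huv
      rcases (hmem w).1 huw with rfl | rfl
      · exact absurd haA hwA
      · rcases hA' a haA w hwA (reduce_adj_self hab) with h | h
        exacts [absurd h haS, Or.inr (Or.inl h)]
    · rcases hA' u (hu.resolve_left huv) w hwA (Or.inl ⟨huv, hwv, huw⟩) with h | h
      exacts [Or.inl h, Or.inr (Or.inl h)]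
  · rcases (hmem z).1 h with h | h
    exacts [absurd h hza, absurd h hzb]

/-- A coloring extends to `v`, where `a`, `v`, `u`, `b` is a path, `v` and `u` have degree two, and `a`
and `b` are nonadjacent. Here `v` is suppressed, and the new edge `au` is marked only if `va` and `vu`
are. So `a` and `u` may have the same color; but every vertex other than `a`, `u` and `v` is
nonadjacent to `a` or to `u` in the reduced graph, and a cut from there also works for `v`. -/
theorem IsStrongColoring.exists_of_path {V : Type*} [Finite V] {G F F' : SimpleGraph V}
    {v u a b : V} {k : ℕ} (hk : 3 ≤ k) (hFG : F ≤ G) (hdegk : ∀ x, G.vdeg x + F.vdeg x ≤ k)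
    (hau : a ≠ u) (hvb : v ≠ b) (hN : G.neighborSet v = {a, u}) (hN' : G.neighborSet u = {v, b})
    (hab : a ≠ b) (hnab : ¬ G.Adj a b) (h2a : 2 ≤ G.vdeg a)
    (hF' : F.reduce {v} a a ≤ F') (hFau : F.Adj v a → F.Adj v u → F'.Adj a u) {c' : V → Fin k}
    (h : (G.reduce {v} a u).IsStrongColoring F' c') :
    ∃ c : V → Fin k, G.IsStrongColoring F c := by
  classical
  have hmem := adj_iff_of_neighborSet_eq_pair hN
  have hmem' := adj_iff_of_neighborSet_eq_pair hN'
  have hva : G.Adj v a := (hmem a).2 (Or.inl rfl)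
  have hvu : G.Adj v u := (hmem u).2 (Or.inr rfl)
  have ha : a ∉ ({v} : Set V) := hva.ne'
  have hu : u ∉ ({v} : Set V) := hvu.ne'
  have hnau : ¬ G.Adj a u := by
    intro h
    rcases (hmem' a).1 h.symm with h | h
    exacts [ha h, hab h]
  have h2u : G.vdeg u = 2 := by rw [vdeg, hN', Set.ncard_pair hvb]
  have h2v : G.vdeg v = 2 := by rw [vdeg, hN, Set.ncard_pair hau]
  obtain ⟨S, ⟨hsep, hr, hS⟩, hSv⟩ := (h.2 a u hau).choose_spec.exists_disjoint (W := {v})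
    fun w hw z => not_reduce_adj ha hu hw z
  obtain ⟨-, hSa, hSu⟩ := hS (reduce_adj_self hau)
  have hda := vdeg_reduce_add_le (G := G) (W := {v}) (a := a) u (T := {v}) subset_rfl
    (by rintro t rfl; exact hva.symm)
  have hdu := vdeg_reduce_add_le (G := G) (W := {v}) (a := u) a (T := {v}) subset_rfl
    (by rintro t rfl; exact hvu.symm)
  rw [reduce_comm] at hdu
  rw [Set.ncard_singleton] at hda hdu
  -- the cut between `a` and `u` has at most one element, as `u` has degree two
  obtain ⟨t, htS, hta, htu, hteq⟩ : ∃ t, (∀ s ∈ S, c' s ≠ t) ∧ (F.Adj v a → t ≠ c' a) ∧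
      (F.Adj v u → t ≠ c' u) ∧ (c' a = c' u → t ≠ c' a) := by
    by_cases heq : c' a = c' u
    · obtain ⟨t, ht, htL⟩ := exists_color c' S [c' a] (by simp; omega)
      have := htL (c' a) (by simp)
      exact ⟨t, ht, fun _ => this, fun _ => heq ▸ this, fun _ => this⟩
    · by_cases hFa : F.Adj v a
      · by_cases hFu : F.Adj v u
        · have : 2 ≤ F.vdeg v := by
            rw [← Set.ncard_pair hau]
            refine Set.ncard_le_ncard ?_
            rintro x (rfl | rfl)
            exacts [hFa, hFu]
          have := hdegk v
          obtain ⟨t, ht, htL⟩ := exists_color c' S [c' a, c' u] (by simp; omega)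
          exact ⟨t, ht, fun _ => htL _ (by simp), fun _ => htL _ (by simp), fun h => absurd h heq⟩
        · obtain ⟨t, ht, htL⟩ := exists_color c' S [c' a] (by simp; omega)
          exact ⟨t, ht, fun _ => htL _ (by simp), fun h => absurd h hFu, fun h => absurd h heq⟩
      · obtain ⟨t, ht, htL⟩ := exists_color c' S [c' u] (by simp; omega)
        exact ⟨t, ht, fun h => absurd h hFa, fun _ => htL _ (by simp), fun h => absurd h heq⟩
  set c := Function.update c' v t with hc
  have hcv : c v = t := Function.update_self ..
  have hcne : ∀ x, x ≠ v → c x = c' x := fun x hx => Function.update_of_ne hx _ _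
  have hca := hcne a ha
  have hcu := hcne u hu
  refine ⟨c, h.of_reduce (W := {v}) (a := a) (b := u) hF' ?_ ha hu
    (fun x _ => ?_) (fun x hx => hcne x hx) ?_ ?_ fun _ => ?_⟩
  · rintro w rfl z hz
    exact Or.inr ((hmem z).1 hz)
  · by_cases hxa : x = a
    · rw [hxa]; omega
    by_cases hxu : x = u
    · rw [hxu]; omega
    exact vdeg_reduce_le G _ (Or.inr hxa) (Or.inr hxu)
  · rintro w rfl z hz
    rcases (hmem z).1 (hFG hz) with rfl | rfl
    · rw [hcv, hca]; exact hta hz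
    · rw [hcv, hcu]; exact htu hz
  · rintro w rfl z hz
    by_cases hza : z = a
    · subst hza
      refine ⟨_, hasCut_neighbor hN hau ?_ h2a⟩
      rw [hcv, hca, hcu]
      by_contra! hcon
      exact hteq hcon.2 (hcon.1.trans hcon.2.symm)
    by_cases hzu : z = u
    · subst hzu
      refine ⟨_, hasCut_neighbor (hN.trans (Set.pair_comm _ _)) hau.symm ?_ h2u.ge⟩
      rw [hcv, hca, hcu]
      by_contra! hcon
      exact hteq hcon.2.symm hcon.1
    -- `z` is not adjacent to both `a` and `u`
    by_cases hadj : (G.reduce {w} a u).Adj a z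
    · have hadj' : ¬ (G.reduce {w} u a).Adj u z := by
        rintro (⟨-, -, h⟩ | ⟨-, ⟨-, h⟩ | ⟨-, h⟩⟩)
        · rcases (hmem' z).1 h with rfl | rfl
          · exact hz rfl
          · rcases hadj with ⟨-, -, h⟩ | ⟨-, ⟨-, h⟩ | ⟨-, h⟩⟩
            exacts [hnab h, hzu h, hza h]
        · exact hza h
        · exact hzu h
      obtain ⟨T, hT⟩ := h.2 u z (Ne.symm hzu)
      rw [reduce_comm] at hT
      exact hT.of_subdivision (hN.trans (Set.pair_comm _ _)) hau.symm hz hzu hza hcne hadj'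
    · obtain ⟨T, hT⟩ := h.2 a z (Ne.symm hza)
      exact hT.of_subdivision hN hau hz hza hzu hcne hadj
  · refine ⟨insert v S, hsep.of_reduce ha (Set.subset_insert _ _) ?_ ?_ ?_, ?_,
      fun h => absurd h hnau⟩
    · rintro (h | h)
      exacts [ha h, hsep.1 h]
    · rintro (h | h)
      exacts [hu h, hsep.2.1 h]
    · rintro w rfl
      exact Or.inl (Or.inl rfl)
    · refine (hr.congr fun s hs => hcne s (hSv s hs)).insert fun s hs => ?_
      rw [hcv, hcne s (hSv s hs)]; exact htS s hs

/-- A coloring extends to two adjacent vertices `v`, `u` of degree two whose other neighbors `a` and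
`b` are distinct and adjacent. One of the two is added to the cut between `a` and `b`. -/
theorem IsStrongColoring.exists_of_square {V : Type*} [Finite V] {G F : SimpleGraph V}
    {v u a b : V} {k : ℕ} (hk : 3 ≤ k) (hFG : F ≤ G) (hdegk : ∀ x, G.vdeg x + F.vdeg x ≤ k)
    (hau : a ≠ u) (hvb : v ≠ b) (hN : G.neighborSet v = {a, u}) (hN' : G.neighborSet u = {v, b})
    (hab : G.Adj a b) {c' : V → Fin k}
    (h : (G.reduce {v, u} a b).IsStrongColoring (F.reduce {v, u} a b) c') :
    ∃ c : V → Fin k, G.IsStrongColoring F c := by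
  classical
  have hmem := adj_iff_of_neighborSet_eq_pair hN
  have hmem' := adj_iff_of_neighborSet_eq_pair hN'
  have hva : G.Adj v a := (hmem a).2 (Or.inl rfl)
  have hvu : G.Adj v u := (hmem u).2 (Or.inr rfl)
  have hub : G.Adj u b := (hmem' b).2 (Or.inr rfl)
  have ha : a ∉ ({v, u} : Set V) := by simp [hva.ne', hau]
  have hb : b ∉ ({v, u} : Set V) := by simp [hub.ne', hvb.symm]
  have hcab : c' a ≠ c' b := h.1 a b (reduce_adj_self hab.ne)
  obtain ⟨S, ⟨hsep, hr, hS⟩, hSv⟩ := (h.2 a b hab.ne).choose_spec.exists_disjoint (W := {v, u})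
    fun w hw z => not_reduce_adj ha hb hw z
  obtain ⟨hrab, hSa, hSb⟩ := hS (reduce_adj_self hab.ne)
  have hda := vdeg_reduce_add_le_of_adj (G := G) (W := {v, u}) (a := a) (b := b) (T := {v})
    (by simp) (by rintro t rfl; exact hva.symm) (Or.inr hab) hb
  have hdb := vdeg_reduce_add_le_of_adj (G := G) (W := {v, u}) (a := b) (b := a) (T := {u})
    (by simp) (by rintro t rfl; exact hub.symm) (Or.inr hab.symm) ha
  rw [reduce_comm] at hdb
  rw [Set.ncard_singleton] at hda hdb
  have hka := hdegk a
  have hkb := hdegk b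
  have h2v : G.vdeg v = 2 := by rw [vdeg, hN, Set.ncard_pair hau]
  have h2u : G.vdeg u = 2 := by rw [vdeg, hN', Set.ncard_pair hvb]
  have hFa : F.Adj v a → S.ncard + 3 ≤ k := fun hF => by
    have : 1 ≤ F.vdeg a := (Set.ncard_pos).2 ⟨v, hF.symm⟩
    omega
  have hFb : F.Adj u b → S.ncard + 3 ≤ k := fun hF => by
    have : 1 ≤ F.vdeg b := (Set.ncard_pos).2 ⟨u, hF.symm⟩
    omega
  have hFa' : F.Adj v a → F.Adj v u → 4 ≤ k := fun h1 h2 => by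
    have : 2 ≤ F.vdeg v := by
      rw [← Set.ncard_pair hau]
      refine Set.ncard_le_ncard ?_
      rintro x (rfl | rfl)
      exacts [h1, h2]
    have := hdegk v
    omega
  have hFb' : F.Adj u b → F.Adj v u → 4 ≤ k := fun h1 h2 => by
    have : 2 ≤ F.vdeg u := by
      rw [← Set.ncard_pair hvb]
      refine Set.ncard_le_ncard ?_
      rintro x (rfl | rfl)
      exacts [h2.symm, h1]
    have := hdegk u
    omega
  -- One of the two new colors enlarges the cut between the ends `p` and `q`. A color different from
  -- those of `p` and `q` is preferred; if there is none, the color of `q` is used.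
  have key : ∀ (p q : V) (Fp Fq Fm : Prop), c' p ≠ c' q → S.ncard + 2 ≤ k →
      (Fp → S.ncard + 3 ≤ k) → (Fq → S.ncard + 3 ≤ k) → (Fq → Fm → 4 ≤ k) →
      ∃ t t', t ≠ c' q ∧ t' ≠ c' p ∧ (Fp → t ≠ c' p) ∧ (Fq → t' ≠ c' q) ∧ (Fm → t ≠ t') ∧
        ((∀ s ∈ S, c' s ≠ t) ∧ t ≠ c' p ∨ (∀ s ∈ S, c' s ≠ t') ∧ t' ≠ c' p) := by
    intro p q Fp Fq Fm hpq h2 hp hq hqm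
    by_cases hex : ∃ t, (∀ s ∈ S, c' s ≠ t) ∧ t ≠ c' p ∧ t ≠ c' q
    · obtain ⟨t, htS, htp, htq⟩ := hex
      by_cases hFq : Fq
      · by_cases hFm : Fm
        · have := hqm hFq hFm
          obtain ⟨t', -, ht'⟩ := exists_color c' ∅ [c' p, c' q, t] (by simp; omega)
          exact ⟨t, t', htq, ht' _ (by simp), fun _ => htp, fun _ => ht' _ (by simp),
            fun _ => (ht' _ (by simp)).symm, Or.inl ⟨htS, htp⟩⟩
        · exact ⟨t, t, htq, htp, fun _ => htp, fun _ => htq, fun h => absurd h hFm,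
            Or.inl ⟨htS, htp⟩⟩
      · exact ⟨t, c' q, htq, hpq.symm, fun _ => htp, fun h => absurd h hFq, fun _ => htq,
          Or.inl ⟨htS, htp⟩⟩
    · have hno : ¬ S.ncard + 3 ≤ k := fun h3 => by
        obtain ⟨t, ht, htL⟩ := exists_color c' S [c' p, c' q] (by simp; omega)
        exact hex ⟨t, ht, htL _ (by simp), htL _ (by simp)⟩
      obtain ⟨t', ht', htL'⟩ := exists_color c' S [c' p] (by simp; omega)
      have htq : t' = c' q := by
        by_contra hne
        exact hex ⟨t', ht', htL' _ (by simp), hne⟩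
      subst htq
      obtain ⟨t, -, ht⟩ := exists_color c' ∅ [c' p, c' q] (by simp; omega)
      exact ⟨t, c' q, ht _ (by simp), hpq.symm, fun _ => ht _ (by simp),
        fun h => absurd (hq h) hno, fun _ => ht _ (by simp), Or.inr ⟨ht', hpq.symm⟩⟩
  obtain ⟨t, t', htb, hta', hta, htb', htt, r, hrab, hrS, ht⟩ : ∃ t t', t ≠ c' b ∧ t' ≠ c' a ∧
      (F.Adj v a → t ≠ c' a) ∧ (F.Adj u b → t' ≠ c' b) ∧ (F.Adj v u → t ≠ t') ∧
      ∃ r, (r = a ∨ r = b) ∧ IsRainbow c' (insert r S) ∧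
        ((∀ s ∈ S, c' s ≠ t) ∧ t ≠ c' r ∨ (∀ s ∈ S, c' s ≠ t') ∧ t' ≠ c' r) := by
    rcases hrab with hr' | hr'
    · obtain ⟨t, t', h1, h2, h3, h4, h5, h6⟩ := key a b _ _ _ hcab (by omega) hFa hFb hFb'
      exact ⟨t, t', h1, h2, h3, h4, h5, a, Or.inl rfl, hr', h6⟩
    · obtain ⟨t, t', h1, h2, h3, h4, h5, h6⟩ := key b a _ _ _ hcab.symm (by omega) hFb hFa hFa'
      exact ⟨t', t, h2, h1, h4, h3, fun h => (h5 h).symm, b, Or.inr rfl, hr', h6.symm⟩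
  set c := Function.update (Function.update c' v t) u t' with hc
  have hcu : c u = t' := Function.update_self ..
  have hcv : c v = t := by rw [hc, Function.update_of_ne hvu.ne, Function.update_self]
  have hcne : ∀ x ∉ ({v, u} : Set V), c x = c' x := fun x hx => by
    simp only [Set.mem_insert_iff, Set.mem_singleton_iff, not_or] at hx
    rw [hc, Function.update_of_ne hx.2, Function.update_of_ne hx.1]
  have hca := hcne a ha
  have hcb := hcne b hb
  have h2a : 2 ≤ G.vdeg a := by omega
  have h2b : 2 ≤ G.vdeg b := by omega
  have hrW : r ∉ ({v, u} : Set V) := by rcases hrab with rfl | rfl <;> assumption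
  -- the cut between `a` and `b` is enlarged by a vertex of `W` of a suitable color
  have hcut : ∀ w ∈ ({v, u} : Set V), (∀ s ∈ S, c' s ≠ c w) → c w ≠ c' r →
      G.Separates (insert w S) a b → G.HasCut c a b (insert w S) := by
    intro w hw hwS hwr hsep'
    have hrain : IsRainbow c (insert r (insert w S)) := by
      rw [Set.insert_comm]
      refine (hrS.congr fun s hs => hcne s ?_).insert ?_
      · rcases hs with rfl | hs
        exacts [hrW, hSv s hs]
      · rintro s (rfl | hs)
        · rw [hcne _ hrW]; exact hwr.symm
        · rw [hcne _ (hSv s hs)]; exact hwS s hs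
    have hle := Set.ncard_insert_le w S
    refine ⟨hsep', hrain.subset (Set.subset_insert _ _), fun _ => ⟨?_, by omega, by omega⟩⟩
    rcases hrab with rfl | rfl
    exacts [Or.inl hrain, Or.inr hrain]
  refine ⟨c, h.of_reduce (W := {v, u}) (a := a) (b := b) (reduce_self_le _ _ _ _ _) ?_ ha hb
    (fun x _ => Set.ncard_le_ncard (reduce_le (Or.inr hab) (v := x))) hcne ?_ ?_ fun _ => ?_⟩
  · rintro w (rfl | rfl) z hz
    · rcases (hmem z).1 hz with rfl | rfl
      exacts [Or.inr (Or.inl rfl), Or.inl (Or.inr rfl)]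
    · rcases (hmem' z).1 hz with rfl | rfl
      exacts [Or.inl (Or.inl rfl), Or.inr (Or.inr rfl)]
  · rintro w (rfl | rfl) z hz
    · rcases (hmem z).1 (hFG hz) with rfl | rfl
      · rw [hcv, hca]; exact hta hz
      · rw [hcv, hcu]; exact htt hz
    · rcases (hmem' z).1 (hFG hz) with rfl | rfl
      · rw [hcv, hcu]; exact (htt hz.symm).symm
      · rw [hcu, hcb]; exact htb' hz
  · rintro w (rfl | rfl) z hz
    · refine exists_hasCut_of_neighborSet_eq_pair hN ?_ h2a h2u.ge hz
      rw [hca, hcu]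
      exact hta'.symm
    · exact exists_hasCut_of_neighborSet_eq_pair hN' (by rwa [hcv, hcb]) h2v.ge h2b hz
  · have haT : ∀ w ∈ ({v, u} : Set V), a ∉ insert w S := by
      rintro w hw (rfl | h)
      exacts [ha hw, hsep.1 h]
    have hbT : ∀ w ∈ ({v, u} : Set V), b ∉ insert w S := by
      rintro w hw (rfl | h)
      exacts [hb hw, hsep.2.1 h]
    have hvW : v ∈ ({v, u} : Set V) := Or.inl rfl
    have huW : u ∈ ({v, u} : Set V) := Or.inr rfl
    rcases ht with ⟨h1, h2⟩ | ⟨h1, h2⟩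
    · refine ⟨insert v S, hcut v hvW (by rwa [hcv]) (by rwa [hcv]) ?_⟩
      refine hsep.of_reduce ha (Set.subset_insert _ _) (haT v hvW) (hbT v hvW) ?_
      rintro w (rfl | rfl)
      · exact Or.inl (Or.inl rfl)
      · refine Or.inr fun z hz hadj => ((hmem' z).1 hadj).resolve_left ?_
        rintro rfl
        exact hz hvW
    · refine ⟨insert u S, hcut u huW (by rwa [hcu]) (by rwa [hcu]) ?_⟩
      have hsep' := hsep.symm
      rw [reduce_comm] at hsep'
      refine (hsep'.of_reduce hb (Set.subset_insert _ _) (hbT u huW) (haT u huW) ?_).symm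
      rintro w (rfl | rfl)
      · refine Or.inr fun z hz hadj => ((hmem z).1 hadj).resolve_right ?_
        rintro rfl
        exact hz huW
      · exact Or.inl (Or.inl rfl)

/-! ### The induction -/

theorem support_reduce_ncard_lt {V : Type*} [Finite V] {G : SimpleGraph V} {W : Set V} {a b v : V}
    (ha : a ∉ W) (hb : b ∉ W) (hv : v ∈ W) (hvG : v ∈ G.support) (haG : a ∈ G.support)
    (hbG : b ∈ G.support) : (G.reduce W a b).support.ncard < G.support.ncard := by
  refine Set.ncard_lt_ncard ⟨?_, fun hsub => ?_⟩
  · rintro x ⟨y, ⟨-, -, h⟩ | ⟨-, ⟨rfl, -⟩ | ⟨rfl, -⟩⟩⟩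
    exacts [h.mem_support_left, haG, hbG]
  · obtain ⟨z, hz⟩ := hsub hvG
    exact not_reduce_adj ha hb hv z hz

/-- If the reduction lowers the degrees of `a` and `b` in `G`, then the new edge `ab` may also be
added to `F`. -/
theorem vdeg_reduce_add_vdeg_reduce_le {V : Type*} [Finite V] {G F : SimpleGraph V} {W : Set V}
    {a b : V} {k : ℕ} (hdegk : ∀ x, G.vdeg x + F.vdeg x ≤ k)
    (ha : (G.reduce W a b).vdeg a + 1 ≤ G.vdeg a) (hb : (G.reduce W b a).vdeg b + 1 ≤ G.vdeg b)
    (x : V) : (G.reduce W a b).vdeg x + (F.reduce W a b).vdeg x ≤ k := by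
  have hk := hdegk x
  by_cases hxa : x = a
  · subst hxa
    have := vdeg_reduce_add_le (G := F) (W := W) (a := x) b (T := ∅) (by simp) (by simp)
    simp only [Set.ncard_empty] at this
    omega
  by_cases hxb : x = b
  · subst hxb
    have := vdeg_reduce_add_le (G := F) (W := W) (a := x) a (T := ∅) (by simp) (by simp)
    simp only [Set.ncard_empty] at this
    rw [reduce_comm G, reduce_comm F]
    omega
  have h1 := vdeg_reduce_le G W (Or.inr hxa : a = b ∨ x ≠ a) (Or.inr hxb)
  have h2 := vdeg_reduce_le F W (Or.inr hxa : a = b ∨ x ≠ a) (Or.inr hxb)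
  omega

/-- No degree grows if a vertex is suppressed: its two neighbors trade one edge for another. -/
theorem vdeg_reduce_le_of_path {V : Type*} [Finite V] {G : SimpleGraph V} {v a u : V}
    (hva : G.Adj v a) (hvu : G.Adj v u) (x : V) : (G.reduce {v} a u).vdeg x ≤ G.vdeg x := by
  by_cases hxa : x = a
  · subst hxa
    have := vdeg_reduce_add_le (G := G) (W := {v}) (a := x) u (T := {v}) subset_rfl
      (by rintro t rfl; exact hva.symm)
    simp only [Set.ncard_singleton] at this
    omega
  by_cases hxu : x = u
  · subst hxu
    have := vdeg_reduce_add_le (G := G) (W := {v}) (a := x) a (T := {v}) subset_rfl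
      (by rintro t rfl; exact hvu.symm)
    simp only [Set.ncard_singleton] at this
    rw [reduce_comm]
    omega
  exact vdeg_reduce_le G _ (Or.inr hxa) (Or.inr hxu)

/-- A `K₄`-minor-free graph `G` with a set `F` of marked edges has a strong coloring with `k ≥ 3`
colors, provided that no vertex has degree greater than `k` when marked edges are counted twice. -/
theorem IsK4MinorFree.exists_isStrongColoring {V : Type*} [Finite V] {k : ℕ} (hk : 3 ≤ k)
    {G F : SimpleGraph V} (hFG : F ≤ G) (hG : G.IsK4MinorFree)
    (hdegk : ∀ x, G.vdeg x + F.vdeg x ≤ k) : ∃ c : V → Fin k, G.IsStrongColoring F c := by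
  induction hm : G.support.ncard using Nat.strong_induction_on generalizing G F with
  | _ m ih =>
  subst hm
  by_cases hE : ∃ x y, G.Adj x y
  swap
  · push Not at hE
    refine ⟨fun _ => ⟨0, by omega⟩, fun x y h => absurd (hFG h) (hE x y), fun x y hxy =>
      ⟨∅, ⟨by simp, by simp, {x}, rfl, hxy.symm, fun u _ w _ h => absurd h (hE u w)⟩,
        isRainbow_of_subsingleton Set.subsingleton_empty, fun h => absurd h (hE x y)⟩⟩
  obtain ⟨x, y, hxy⟩ := hE
  by_cases hone : ∃ v a, G.neighborSet v = {a}
  · obtain ⟨v, a, hN⟩ := hone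
    have hva : G.Adj v a := by rw [← mem_neighborSet, hN]; rfl
    have ha : a ∉ ({v} : Set V) := hva.ne'
    obtain ⟨c', hc'⟩ := ih _ (support_reduce_ncard_lt ha ha rfl hva.mem_support_left
      hva.mem_support_right hva.mem_support_right) (reduce_mono hFG {v} a a)
      (hG.mono (reduce_le (Or.inl rfl)))
      (fun x => (add_le_add (vdeg_reduce_le G _ (Or.inl rfl) (Or.inl rfl))
        (vdeg_reduce_le F _ (Or.inl rfl) (Or.inl rfl))).trans (hdegk x)) rfl
    exact hc'.exists_of_pendant hk hFG hN
  have h2 : ∀ {z w}, G.Adj z w → 2 ≤ G.vdeg z := by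
    intro z w hzw
    have h0 : 0 < G.vdeg z := (Set.ncard_pos).2 ⟨w, hzw⟩
    have h1 : G.vdeg z ≠ 1 := by
      intro h
      obtain ⟨a, ha⟩ := Set.ncard_eq_one.1 h
      exact hone ⟨z, a, ha⟩
    omega
  have htriangle : ∀ v a b, G.neighborSet v = {a, b} → G.Adj a b →
      ∃ c : V → Fin k, G.IsStrongColoring F c := by
    intro v a b hN hab
    have hmem := adj_iff_of_neighborSet_eq_pair hN
    have hva : G.Adj v a := (hmem a).2 (Or.inl rfl)
    have hvb : G.Adj v b := (hmem b).2 (Or.inr rfl)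
    have ha : a ∉ ({v} : Set V) := hva.ne'
    have hb : b ∉ ({v} : Set V) := hvb.ne'
    have hda := vdeg_reduce_add_le_of_adj (G := G) (W := {v}) (a := a) (b := b) (T := {v})
      subset_rfl (by rintro t rfl; exact hva.symm) (Or.inr hab) hb
    have hdb := vdeg_reduce_add_le_of_adj (G := G) (W := {v}) (a := b) (b := a) (T := {v})
      subset_rfl (by rintro t rfl; exact hvb.symm) (Or.inr hab.symm) ha
    rw [Set.ncard_singleton] at hda hdb
    obtain ⟨c', hc'⟩ := ih _ (support_reduce_ncard_lt ha hb rfl hva.mem_support_left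
      hva.mem_support_right hvb.mem_support_right) (reduce_mono hFG {v} a b)
      (hG.mono (reduce_le (Or.inr hab))) (vdeg_reduce_add_vdeg_reduce_le hdegk hda hdb) rfl
    exact hc'.exists_of_triangle hFG hdegk hN hab
  rcases hG.exists_reducible hxy with ⟨v, a, hN⟩ | ⟨v, a, b, -, hN, hab⟩ |
    ⟨v, v', a, b, hvv, hab, hN, hN'⟩ | ⟨v, u, a, b, hau, hvb, hN, hN'⟩
  · exact absurd ⟨v, a, hN⟩ hone
  · exact htriangle v a b hN hab
  · by_cases hadj : G.Adj a b
    · exact htriangle v a b hN hadj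
    have hmem := adj_iff_of_neighborSet_eq_pair hN
    have hmem' := adj_iff_of_neighborSet_eq_pair hN'
    have hva : G.Adj v a := (hmem a).2 (Or.inl rfl)
    have hvb : G.Adj v b := (hmem b).2 (Or.inr rfl)
    have hva' : G.Adj v' a := (hmem' a).2 (Or.inl rfl)
    have hvb' : G.Adj v' b := (hmem' b).2 (Or.inr rfl)
    have ha : a ∉ ({v, v'} : Set V) := by simp [hva.ne', hva'.ne']
    have hb : b ∉ ({v, v'} : Set V) := by simp [hvb.ne', hvb'.ne']
    have hda := vdeg_reduce_add_le (G := G) (W := {v, v'}) (a := a) b (T := {v, v'}) subset_rfl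
      (by rintro t (rfl | rfl) <;> exact Adj.symm ‹_›)
    have hdb := vdeg_reduce_add_le (G := G) (W := {v, v'}) (a := b) a (T := {v, v'}) subset_rfl
      (by rintro t (rfl | rfl) <;> exact Adj.symm ‹_›)
    rw [Set.ncard_pair hvv] at hda hdb
    have hK4 : (G.reduce {v, v'} a b).IsK4MinorFree := by
      refine hG.of_suppress (v := v) (a := a) (b := b) ?_ hva hvb ?_
      · rintro ⟨z, hz⟩
        exact not_reduce_adj ha hb (Or.inl rfl) z hz
      · rintro x y (⟨-, -, h⟩ | ⟨-, h⟩)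
        exacts [Or.inl h, Or.inr h]
    obtain ⟨c', hc'⟩ := ih _ (support_reduce_ncard_lt ha hb (Or.inl rfl) hva.mem_support_left
      hva.mem_support_right hvb.mem_support_right) (reduce_mono hFG {v, v'} a b)
      hK4 (vdeg_reduce_add_vdeg_reduce_le hdegk (by omega) (by omega)) rfl
    exact hc'.exists_of_twins hFG hdegk hvv hab hN hN' hadj
  · have hmem := adj_iff_of_neighborSet_eq_pair hN
    have hmem' := adj_iff_of_neighborSet_eq_pair hN'
    have hva : G.Adj v a := (hmem a).2 (Or.inl rfl)
    have hvu : G.Adj v u := (hmem u).2 (Or.inr rfl)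
    have hub : G.Adj u b := (hmem' b).2 (Or.inr rfl)
    by_cases hab : a = b
    · subst hab
      exact htriangle v a u hN hub.symm
    by_cases hadj : G.Adj a b
    · have ha : a ∉ ({v, u} : Set V) := by simp [hva.ne', hau]
      have hb : b ∉ ({v, u} : Set V) := by simp [hub.ne', hvb.symm]
      have hda := vdeg_reduce_add_le_of_adj (G := G) (W := {v, u}) (a := a) (b := b) (T := {v})
        (by simp) (by rintro t rfl; exact hva.symm) (Or.inr hadj) hb
      have hdb := vdeg_reduce_add_le_of_adj (G := G) (W := {v, u}) (a := b) (b := a) (T := {u})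
        (by simp) (by rintro t rfl; exact hub.symm) (Or.inr hadj.symm) ha
      rw [Set.ncard_singleton] at hda hdb
      obtain ⟨c', hc'⟩ := ih _ (support_reduce_ncard_lt ha hb (Or.inl rfl) hva.mem_support_left
        hva.mem_support_right hub.mem_support_right) (reduce_mono hFG {v, u} a b)
        (hG.mono (reduce_le (Or.inr hadj))) (vdeg_reduce_add_vdeg_reduce_le hdegk hda hdb) rfl
      exact hc'.exists_of_square hk hFG hdegk hau hvb hN hN' hadj
    · have ha : a ∉ ({v} : Set V) := hva.ne'
      have hu : u ∉ ({v} : Set V) := hvu.ne'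
      have hK4 : (G.reduce {v} a u).IsK4MinorFree := by
        refine hG.of_suppress (v := v) (a := a) (b := u) ?_ hva hvu ?_
        · rintro ⟨z, hz⟩
          exact not_reduce_adj ha hu rfl z hz
        · rintro x y (⟨-, -, h⟩ | ⟨-, h⟩)
          exacts [Or.inl h, Or.inr h]
      have hlt := support_reduce_ncard_lt ha hu rfl hva.mem_support_left hva.mem_support_right
        hvu.mem_support_right
      by_cases hF : F.Adj v a ∧ F.Adj v u
      · obtain ⟨c', hc'⟩ := ih _ hlt (reduce_mono hFG {v} a u) hK4
          (fun x => (add_le_add (vdeg_reduce_le_of_path hva hvu x)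
            (vdeg_reduce_le_of_path hF.1 hF.2 x)).trans (hdegk x)) rfl
        exact hc'.exists_of_path hk hFG hdegk hau hvb hN hN' hab hadj (h2 hva.symm)
          (reduce_self_le _ _ _ _ _) fun _ _ => reduce_adj_self hau
      · obtain ⟨c', hc'⟩ := ih _ hlt ((reduce_mono hFG {v} a a).trans (reduce_self_le _ _ _ _ _))
          hK4 (fun x => (add_le_add (vdeg_reduce_le_of_path hva hvu x)
            (vdeg_reduce_le F _ (Or.inl rfl) (Or.inl rfl))).trans (hdegk x)) rfl
        exact hc'.exists_of_path hk hFG hdegk hau hvb hN hN' hab hadj (h2 hva.symm) le_rfl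
          fun h1 h2 => absurd ⟨h1, h2⟩ hF

/-! ### Maximum degree at most two -/

/-- A connected graph of maximum degree at most two is a path or a cycle: its vertices can be
numbered such that adjacent vertices have consecutive numbers or are the first and the last. -/
theorem Connected.exists_position {V : Type*} [Finite V] [Nontrivial V] {G : SimpleGraph V}
    (hG : G.Connected) (hdeg : ∀ x, G.vdeg x ≤ 2) :
    ∃ (n : ℕ) (p : V → ℕ), Function.Injective p ∧ (∀ x, p x ≤ n) ∧ (∀ t ≤ n, ∃ x, p x = t) ∧
      ∀ x y, G.Adj x y → p x < p y → p y = p x + 1 ∨ p x = 0 ∧ p y = n := by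
  classical
  obtain ⟨x₀⟩ := hG.nonempty
  obtain ⟨y₀, hxy⟩ := hG.preconnected.exists_adj_of_nontrivial x₀
  obtain ⟨n, f, hn, hf, hmax⟩ := exists_longest_isPathSeq hxy
  -- the last vertex of the path has its neighbors on the path, too
  have hrev : G.IsPathSeq n fun t => f (n - t) := by
    refine ⟨fun s hs t ht hst => ?_, fun t ht => ?_⟩
    · have hs' : s ≤ n := hs
      have ht' : t ≤ n := ht
      have := hf.1 (show n - s ≤ n by omega) (show n - t ≤ n by omega) hst
      omega
    · have := hf.2 (n - (t + 1)) (by omega)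
      rw [show n - (t + 1) + 1 = n - t by omega] at this
      exact this.symm
  have hinner : ∀ t, 1 ≤ t → t < n → ∀ w, G.Adj (f t) w → w = f (t - 1) ∨ w = f (t + 1) := by
    intro t h1 htn w hw
    have hprev := hf.2 (t - 1) (by omega)
    rw [show t - 1 + 1 = t by omega] at hprev
    have hne : f (t - 1) ≠ f (t + 1) := fun h => by
      have := hf.1 (show t - 1 ≤ n by omega) (show t + 1 ≤ n by omega) h
      omega
    by_contra! hcon
    have h3 : ({w, f (t - 1), f (t + 1)} : Set V) ⊆ G.neighborSet (f t) := by
      rintro z (rfl | rfl | rfl)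
      exacts [hw, hprev.symm, hf.2 t htn]
    have h4 := Set.ncard_le_ncard h3
    rw [Set.ncard_eq_three.2 ⟨w, f (t - 1), f (t + 1), hcon.1, hcon.2, hne, rfl⟩] at h4
    have := h4.trans (hdeg (f t))
    omega
  have hadj : ∀ s t, s ≤ n → G.Adj (f s) (f t) → s < t → t ≤ n → t = s + 1 ∨ s = 0 ∧ t = n := by
    intro s t hs hst hlt ht
    by_cases h0 : s = 0
    · by_cases htn : t = n
      · exact Or.inr ⟨h0, htn⟩
      · rcases hinner t (by omega) (by omega) _ hst.symm with h | h <;>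
          have := hf.1 (show s ≤ n from hs) (by simp only [Set.mem_Iic]; omega) h <;> omega
    · rcases hinner s (by omega) (by omega) _ hst with h | h <;>
        have := hf.1 (show t ≤ n from ht) (by simp only [Set.mem_Iic]; omega) h <;> omega
  have hclosed : ∀ t ≤ n, ∀ w, G.Adj (f t) w → ∃ s ≤ n, f s = w := by
    intro t ht w hw
    by_cases h0 : t = 0
    · subst h0
      obtain ⟨s, -, hs, h⟩ := hf.exists_eq_of_adj hmax hw
      exact ⟨s, hs, h⟩
    by_cases hn' : t = n
    · subst hn'
      obtain ⟨s, -, hs, h⟩ := hrev.exists_eq_of_adj hmax (w := w) (by simpa using hw)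
      exact ⟨t - s, by omega, h⟩
    · rcases hinner t (by omega) (by omega) w hw with h | h
      exacts [⟨t - 1, by omega, h.symm⟩, ⟨t + 1, by omega, h.symm⟩]
  -- the vertices of the path are closed under adjacency, so that they are all vertices
  have hall : ∀ w, ∃ s ≤ n, f s = w := by
    intro w
    obtain ⟨q⟩ := hG.preconnected (f 0) w
    have hwalk : ∀ u w (_ : G.Walk u w), (∃ s ≤ n, f s = u) → ∃ s ≤ n, f s = w := by
      intro u w q
      induction q with
      | nil => exact id
      | cons h _ ih =>
        rintro ⟨s, hs, rfl⟩
        exact ih (hclosed s hs _ h)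
    exact hwalk _ _ q ⟨0, Nat.zero_le _, rfl⟩
  choose p hp hfp using hall
  refine ⟨n, p, fun x y h => ?_, hp, fun t ht => ⟨f t, hf.1 (hp _) ht (hfp _)⟩,
    fun x y hxy hlt => hadj _ _ (hp x) ?_ hlt (hp y)⟩
  · rw [← hfp x, ← hfp y, h]
  · rwa [hfp, hfp]

/-- On a path or a cycle, color the first two vertices with one color and all others with another
one. -/
theorem Connected.exists_isRVDColoring_two {V : Type*} [Finite V] [Nontrivial V]
    {G : SimpleGraph V} (hG : G.Connected) (hdeg : ∀ x, G.vdeg x ≤ 2) :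
    ∃ c : V → Fin 2, G.IsRVDColoring c := by
  classical
  obtain ⟨n, p, hinj, hle, hsurj, hadj⟩ := hG.exists_position hdeg
  have hcross : ∀ u w, G.Adj u w → p w = p u + 1 ∨ p u = p w + 1 ∨ p u = 0 ∧ p w = n ∨
      p w = 0 ∧ p u = n := by
    intro u w huw
    rcases lt_or_gt_of_ne (fun h => huw.ne (hinj h)) with h | h
    · rcases hadj u w huw h with h' | h' <;> tauto
    · rcases hadj w u huw.symm h with h' | h' <;> tauto
  set c : V → Fin 2 := fun x => if p x ≤ 1 then 0 else 1 with hc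
  have hc01 : ∀ x y, p x ≤ 1 → 2 ≤ p y → c x ≠ c y := by
    intro x y hx hy
    simp [hc, hx, show ¬ p y ≤ 1 by omega]
  refine ⟨c, ?_⟩
  have key : ∀ x y, p x < p y → ∃ S, G.IsRainbowVertexCut c x y S := by
    intro x y hxy
    have hyn := hle y
    -- the first and the last vertex, which may be adjacent
    by_cases h0n : p x = 0 ∧ p y = n
    · by_cases hn1 : n ≤ 1
      · refine ⟨∅, Separates.isVertexCut ⟨by simp, by simp, {x}, rfl, fun h => ?_, ?_⟩,
          fun _ => isRainbow_of_subsingleton Set.subsingleton_empty,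
          fun _ => Or.inl (isRainbow_of_subsingleton (by simp))⟩
        · rw [Set.mem_singleton_iff.1 h] at hxy; omega
        · rintro u rfl w hw huw
          refine Or.inr (Or.inr ⟨rfl, hinj ?_⟩)
          have := hle w
          have : p w ≠ p u := fun h => hw (hinj h)
          omega
      · obtain ⟨m, hm⟩ := hsurj 1 (by omega)
        refine ⟨{m}, Separates.isVertexCut ⟨?_, ?_, {x}, rfl, fun h => ?_, ?_⟩,
          fun _ => isRainbow_of_subsingleton Set.subsingleton_singleton,
          fun _ => Or.inr (isRainbow_pair (hc01 m y (by omega) (by omega)).symm)⟩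
        · rintro rfl; omega
        · rintro rfl; omega
        · rw [Set.mem_singleton_iff.1 h] at hxy; omega
        · rintro u rfl w hw huw
          have h1 : p w = 1 → w = m := fun h => hinj (h.trans hm.symm)
          have h2 : p w = n → w = y := fun h => hinj (h.trans h0n.2.symm)
          rcases hcross u w huw with h | h | h | h
          · exact Or.inr (Or.inl (h1 (by omega)))
          · omega
          · exact Or.inr (Or.inr ⟨rfl, h2 h.2⟩)
          · omega
    by_cases hcons : p y = p x + 1
    · -- one vertex outside of the edge `xy` whose color differs from that of `x` or of `y`
      obtain ⟨m, hm, hcol⟩ : ∃ m, (p m < p x ∨ p y < p m) ∧ (c x ≠ c m ∨ c y ≠ c m) := by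
        by_cases h0 : p x = 0
        · obtain ⟨m, hm⟩ := hsurj 2 (by omega)
          exact ⟨m, Or.inr (by omega), Or.inl (hc01 x m (by omega) (by omega))⟩
        · obtain ⟨m, hm⟩ := hsurj 0 (by omega)
          exact ⟨m, Or.inl (by omega), Or.inr (hc01 m y (by omega) (by omega)).symm⟩
      refine ⟨{m}, Separates.isVertexCut ?_,
        fun _ => isRainbow_of_subsingleton Set.subsingleton_singleton,
        fun _ => hcol.imp isRainbow_pair isRainbow_pair⟩
      have hxm : x ∉ ({m} : Set V) := by rintro rfl; omega
      have hym : y ∉ ({m} : Set V) := by rintro rfl; omega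
      rcases hm with hm | hm
      · refine ⟨hxm, hym, {z | p m < p z ∧ p z ≤ p x}, ⟨hm, le_rfl⟩, fun h => ?_, ?_⟩
        · have := h.2; omega
        · rintro u ⟨hu1, hu2⟩ w hw huw
          have h1 : p w = p m → w = m := fun h => hinj h
          have h2 : p w = p y → w = y := fun h => hinj h
          have h3 : p u = p x → u = x := fun h => hinj h
          have hw' : p m < p w → p x < p w := fun h => by
            by_contra h'; exact hw ⟨h, by omega⟩
          have := hle w
          rcases hcross u w huw with h | h | h | h
          · exact Or.inr (Or.inr ⟨h3 (by omega), h2 (by omega)⟩)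
          · exact Or.inr (Or.inl (h1 (by omega)))
          · omega
          · omega
      · refine ⟨hxm, hym, {z | p z ≤ p x ∨ p m ≤ p z}, Or.inl le_rfl, fun h => ?_, ?_⟩
        · rcases h with h | h <;> omega
        · rintro u hu w hw huw
          have hu' : p u ≤ p x ∨ p m ≤ p u := hu
          have hw' : ¬ (p w ≤ p x ∨ p m ≤ p w) := hw
          have h1 : p u = p m → u = m := fun h => hinj h
          have h2 : p w = p y → w = y := fun h => hinj h
          have h3 : p u = p x → u = x := fun h => hinj h
          have := hle m
          rcases hcross u w huw with h | h | h | h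
          · exact Or.inr (Or.inr ⟨h3 (by omega), h2 (by omega)⟩)
          · exact Or.inl (h1 (by omega))
          · omega
          · omega
    · have hnadj : ¬ G.Adj x y := by
        intro h
        rcases hadj x y h hxy with h | h
        exacts [hcons h, h0n h]
      -- one vertex between `x` and `y`, and one outside, of different colors
      obtain ⟨m, q, hxm, hmy, hq, hcol⟩ : ∃ m q, p x < p m ∧ p m < p y ∧
          (p q < p x ∨ p y < p q) ∧ c m ≠ c q := by
        by_cases h0 : p x = 0
        · obtain ⟨m, hm⟩ := hsurj 1 (by omega)
          obtain ⟨q, hq⟩ := hsurj n le_rfl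
          exact ⟨m, q, by omega, by omega, Or.inr (by omega), hc01 m q (by omega) (by omega)⟩
        · obtain ⟨m, hm⟩ := hsurj (p x + 1) (by omega)
          obtain ⟨q, hq⟩ := hsurj 0 (by omega)
          exact ⟨m, q, by omega, by omega, Or.inl (by omega),
            (hc01 q m (by omega) (by omega)).symm⟩
      refine ⟨{m, q}, Separates.isVertexCut ?_, fun _ => isRainbow_pair hcol,
        fun h => absurd h hnadj⟩
      have hxS : x ∉ ({m, q} : Set V) := by rintro (rfl | rfl) <;> omega
      have hyS : y ∉ ({m, q} : Set V) := by rintro (rfl | rfl) <;> omega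
      rcases hq with hq | hq
      · refine ⟨hxS, hyS, {z | p q < p z ∧ p z ≤ p m}, ⟨hq, hxm.le⟩, fun h => ?_, ?_⟩
        · have := h.2; omega
        · rintro u ⟨hu1, hu2⟩ w hw huw
          have h1 : p w = p q → w = q := fun h => hinj h
          have h2 : p u = p m → u = m := fun h => hinj h
          have hw' : p q < p w → p m < p w := fun h => by
            by_contra h'; exact hw ⟨h, by omega⟩
          have := hle w
          rcases hcross u w huw with h | h | h | h
          · exact Or.inl (Or.inl (h2 (by omega)))
          · exact Or.inr (Or.inl (Or.inr (h1 (by omega))))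
          · omega
          · omega
      · refine ⟨hxS, hyS, {z | p z ≤ p m ∨ p q ≤ p z}, Or.inl hxm.le, fun h => ?_, ?_⟩
        · rcases h with h | h <;> omega
        · rintro u hu w hw huw
          have hu' : p u ≤ p m ∨ p q ≤ p u := hu
          have hw' : ¬ (p w ≤ p m ∨ p q ≤ p w) := hw
          have h1 : p u = p q → u = q := fun h => hinj h
          have h2 : p u = p m → u = m := fun h => hinj h
          have := hle q
          rcases hcross u w huw with h | h | h | h
          · exact Or.inl (Or.inl (h2 (by omega)))
          · exact Or.inl (Or.inr (h1 (by omega)))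
          · omega
          · omega
  intro x y hxy
  rcases lt_or_gt_of_ne fun h => hxy (hinj h) with h | h
  · exact key x y h
  · obtain ⟨S, ⟨hS1, hS2⟩, hS3, hS4⟩ := key y x h
    have hsymm : ∀ (H : SimpleGraph V) u w, H.InDifferentComponents S u w →
        H.InDifferentComponents S w u := fun H u w ⟨hu, hw, h⟩ => ⟨hw, hu, h.symm⟩
    refine ⟨S, ⟨fun hn => hsymm _ _ _ (hS1 fun h => hn h.symm), fun ha => ?_⟩,
      fun hn => hS3 fun h => hn h.symm, fun ha => (hS4 ha.symm).symm⟩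
    rw [Sym2.eq_swap]
    exact hsymm _ _ _ (hS2 ha.symm)

/-- If all degrees are at most one, the neighborhood of `x` without `y` is a cut with at most one
element. -/
theorem exists_isRVDColoring_one {V : Type*} [Finite V] {G : SimpleGraph V}
    (hdeg : ∀ x, G.vdeg x ≤ 1) : ∃ c : V → Fin 1, G.IsRVDColoring c := by
  refine ⟨fun _ => 0, fun x y hxy => ?_⟩
  have hsub : (G.neighborSet x).Subsingleton := Set.ncard_le_one_iff_subsingleton.1 (hdeg x)
  refine ⟨G.neighborSet x \ {y}, Separates.isVertexCut ⟨fun h => G.irrefl h.1, fun h => h.2 rfl,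
    {x}, rfl, hxy.symm, ?_⟩, fun _ => isRainbow_of_subsingleton (hsub.anti Set.sdiff_subset),
    fun hadj => Or.inl (isRainbow_of_subsingleton ?_)⟩
  · rintro u rfl w - huw
    by_cases hwy : w = y
    · exact Or.inr (Or.inr ⟨rfl, hwy⟩)
    · exact Or.inr (Or.inl ⟨huw, hwy⟩)
  · have : G.neighborSet x \ {y} = ∅ := Set.eq_empty_of_forall_notMem fun z hz =>
      hz.2 (hsub hz.1 hadj)
    rw [this]
    simp

theorem Connected.rvd_le_maxDegree {V : Type*} [Fintype V] [Nontrivial V] {G : SimpleGraph V}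
    [DecidableRel G.Adj] (hG : G.Connected) (hK4 : G.IsK4MinorFree) : G.rvd ≤ G.maxDegree := by
  have hdeg : ∀ x, G.vdeg x ≤ G.maxDegree := fun x => by
    have h := G.degree_le_maxDegree x
    rwa [← card_neighborSet_eq_degree, ← Set.toFinset_card, ← Set.ncard_eq_toFinset_card'] at h
  suffices h : ∃ c : V → Fin G.maxDegree, G.IsRVDColoring c from Nat.sInf_le h
  have hpos : 0 < G.maxDegree := by
    obtain ⟨x⟩ := hG.nonempty
    obtain ⟨y, hxy⟩ := hG.preconnected.exists_adj_of_nontrivial x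
    exact ((Set.ncard_pos).2 ⟨y, hxy⟩).trans_le (hdeg x)
  generalize G.maxDegree = k at hdeg hpos
  obtain rfl | rfl | hk : k = 1 ∨ k = 2 ∨ 3 ≤ k := by omega
  · exact exists_isRVDColoring_one hdeg
  · exact hG.exists_isRVDColoring_two hdeg
  · obtain ⟨c, -, hc⟩ := hK4.exists_isStrongColoring hk (bot_le : ⊥ ≤ G) fun x => by
      have : (⊥ : SimpleGraph V).vdeg x = 0 := by simp [vdeg, neighborSet]
      rw [this]
      exact hdeg x
    exact ⟨c, fun x y hxy => (hc x y hxy).imp fun S hS => hS.isRainbowVertexCut⟩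

/-! ### Complete bipartite graphs with a side of two vertices -/

theorem completeBipartiteGraph_two_connected {m : ℕ} (hm : 0 < m) :
    (completeBipartiteGraph (Fin 2) (Fin m)).Connected := by
  have h : ∀ i j, (completeBipartiteGraph (Fin 2) (Fin m)).Reachable (Sum.inl i) (Sum.inr j) :=
    fun i j => Adj.reachable (by simp)
  rw [connected_iff_exists_forall_reachable]
  refine ⟨Sum.inr ⟨0, hm⟩, ?_⟩
  rintro (i | j)
  · exact (h i _).symm
  · exact (h 0 _).symm.trans (h 0 j)

/-- Two of four disjoint sets avoid the side with two vertices, and there are no edges between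
them. -/
theorem completeBipartiteGraph_two_isK4MinorFree (m : ℕ) :
    (completeBipartiteGraph (Fin 2) (Fin m)).IsK4MinorFree := by
  classical
  rintro ⟨B, -, hdis, hadj⟩
  have huniq : ∀ v i j, v ∈ B i → v ∈ B j → i = j := fun v i j hi hj =>
    by_contra fun h => Set.disjoint_left.1 (hdis i j h) hi hj
  have hsel : ∀ l : Fin 2, ∃ i, ∀ j, (Sum.inl l : Fin 2 ⊕ Fin m) ∈ B j → j = i := by
    intro l
    by_cases h : ∃ j, (Sum.inl l : Fin 2 ⊕ Fin m) ∈ B j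
    · obtain ⟨j, hj⟩ := h
      exact ⟨j, fun j' hj' => huniq _ _ _ hj' hj⟩
    · exact ⟨0, fun j hj => absurd ⟨j, hj⟩ h⟩
  choose s hs using hsel
  obtain ⟨i, j, hij, hi, hj⟩ : ∃ i j : Fin 4, i ≠ j ∧ (i ≠ s 0 ∧ i ≠ s 1) ∧ j ≠ s 0 ∧ j ≠ s 1 := by
    generalize s 0 = p
    generalize s 1 = q
    revert p q
    decide
  have hinl : ∀ i, i ≠ s 0 ∧ i ≠ s 1 → ∀ l, (Sum.inl l : Fin 2 ⊕ Fin m) ∉ B i := by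
    intro i hi l hl
    have := hs l i hl
    fin_cases l
    exacts [hi.1 this, hi.2 this]
  obtain ⟨u, hu, w, hw, huw⟩ := hadj i j hij
  rcases u with u | u
  · exact hinl i hi u hu
  rcases w with w | w
  · exact hinl j hj w hw
  simp at huw

/-- A cut between the two vertices of the small side contains the whole other side. -/
theorem le_rvd_completeBipartiteGraph_two (m : ℕ) :
    m ≤ (completeBipartiteGraph (Fin 2) (Fin m)).rvd := by
  obtain ⟨c, hc⟩ := exists_isRVDColoring_rvd (completeBipartiteGraph (Fin 2) (Fin m))
  obtain ⟨S, ⟨hS, -⟩, hr, -⟩ := hc (Sum.inl 0) (Sum.inl 1) (by simp)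
  obtain ⟨h0, h1, hne⟩ := hS (by simp)
  have hall : ∀ j, Sum.inr j ∈ S := by
    intro j
    by_contra hj
    have hadj0 : ((completeBipartiteGraph (Fin 2) (Fin m)).induce Sᶜ).Adj
        ⟨Sum.inl 0, h0⟩ ⟨Sum.inr j, hj⟩ := by simp
    have hadj1 : ((completeBipartiteGraph (Fin 2) (Fin m)).induce Sᶜ).Adj
        ⟨Sum.inr j, hj⟩ ⟨Sum.inl 1, h1⟩ := by simp
    exact hne (ConnectedComponent.sound (hadj0.reachable.trans hadj1.reachable))
  have hinj : Function.Injective fun j : Fin m => c (Sum.inr j) := by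
    intro i j hij
    by_contra hne
    exact hr (by simp) _ (hall i) _ (hall j) (fun h => hne (Sum.inr_injective h)) hij
  simpa using Fintype.card_le_of_injective _ hinj

theorem maxDegree_completeBipartiteGraph_two {m : ℕ} (hm : 2 ≤ m)
    [DecidableRel (completeBipartiteGraph (Fin 2) (Fin m)).Adj] :
    (completeBipartiteGraph (Fin 2) (Fin m)).maxDegree = m := by
  have hl : ∀ i, (completeBipartiteGraph (Fin 2) (Fin m)).degree (Sum.inl i) = m := by
    intro i
    rw [← card_neighborFinset_eq_degree]
    have : (completeBipartiteGraph (Fin 2) (Fin m)).neighborFinset (Sum.inl i) =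
        Finset.univ.map Function.Embedding.inr := by
      ext (u | u) <;> simp
    rw [this]
    simp
  have hr : ∀ j, (completeBipartiteGraph (Fin 2) (Fin m)).degree (Sum.inr j) = 2 := by
    intro j
    rw [← card_neighborFinset_eq_degree]
    have : (completeBipartiteGraph (Fin 2) (Fin m)).neighborFinset (Sum.inr j) =
        Finset.univ.map Function.Embedding.inl := by
      ext (u | u) <;> simp
    rw [this]
    simp
  refine le_antisymm (maxDegree_le_of_forall_degree_le _ _ ?_) ?_
  · rintro (i | j)
    exacts [(hl i).le, (hr j).le.trans hm]
  · exact (hl 0).symm.le.trans (degree_le_maxDegree _ _)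

end SimpleGraph

theorem mainTheorem1 :
    (∀ (V : Type*) [Fintype V] [Nontrivial V] (G : SimpleGraph V) [DecidableRel G.Adj],
      G.Connected → G.IsK4MinorFree → G.rvd ≤ G.maxDegree) ∧
    (∀ (n : ℕ) [DecidableRel (completeBipartiteGraph (Fin 2) (Fin (n - 2))).Adj], 4 ≤ n →
      (completeBipartiteGraph (Fin 2) (Fin (n - 2))).Connected ∧
      (completeBipartiteGraph (Fin 2) (Fin (n - 2))).IsK4MinorFree ∧
      (completeBipartiteGraph (Fin 2) (Fin (n - 2))).rvd = n - 2 ∧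
      (completeBipartiteGraph (Fin 2) (Fin (n - 2))).maxDegree = n - 2) := by
  refine ⟨fun _ _ _ _ _ hG hK4 => hG.rvd_le_maxDegree hK4, fun n _ hn => ?_⟩
  have hconn := SimpleGraph.completeBipartiteGraph_two_connected (m := n - 2) (by omega)
  have hK4 := SimpleGraph.completeBipartiteGraph_two_isK4MinorFree (n - 2)
  have hmax := SimpleGraph.maxDegree_completeBipartiteGraph_two (m := n - 2) (by omega)
  have : Nontrivial (Fin 2 ⊕ Fin (n - 2)) := ⟨Sum.inl 0, Sum.inl 1, by simp⟩
  exact ⟨hconn, hK4, le_antisymm ((hconn.rvd_le_maxDegree hK4).trans_eq hmax)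
    (SimpleGraph.le_rvd_completeBipartiteGraph_two _), hmax⟩
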